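/- Let $k$ be an algebraically closed field, let $Q$ be a finite connected (non-empty) quiver and let $\Lambda = kQ/I$, where $I$ is an admissible ideal of the path algebra $kQ$ that is generated by paths of length $2$ (so $\Lambda$ is a quadratic monomial algebra). For integers $r,s\ge 1$, the $(r,s)$-star quiver $S_{(r,s)}$ is the quiver with $r+s+1$ vertices: a central vertex $z$, vertices $1,\dots,r$ with one arrow $a_i\colon i\to z$ each, and vertices $1',\dots,s'$ with one arrow $b_j\colon z\to j'$ each. (1) If $\Lambda$ has global dimension $2$ and $\operatorname{Ext}^1_{\Lambda^e}(\Lambda,\Lambda^e)=0$, where $\Lambda^e=\Lambda\otimes_k\Lambda^{\mathrm{op}}$, then $Q$ is isomorphic to $S_{(r,s)}$ for some $r,s\ge 1$. (2) In particular, suppose that $\Lambda$ is $2$-hereditary, that is, $\Lambda$ is finite-dimensional of global dimension $2$ and $H^j(\mathbb S_2^i(\Lambda))=0$ for all $i,j\in\mathbb Z$ with $j\notin 2\mathbb Z$, where $\mathbb S_2=\mathbb S\circ[-2]$ and $\mathbb S=D\Lambda\otimes^{\mathbf L}_\Lambda-$ is the Serre functor of $D^b(\mathsf{mod}\,\Lambda)$,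 with inverse $\mathbf R\mathrm{Hom}_\Lambda(D\Lambda,-)$ and $D=\mathrm{Hom}_k(-,k)$. Then, for some $r,s\ge 1$, $Q\cong S_{(r,s)}$ and $\Lambda\cong kS_{(r,s)}/J$ as $k$-algebras for an admissible ideal $J$ generated by paths of length $2$. -/

import Mathlib

open CategoryTheory

universe u

noncomputable section

namespace StarCor

/-! ### Path algebras and bound quiver algebras -/

/-- The type of all paths (of any length `≥ 0`) of a quiver, with their tail and their head:
`⟨i, j, p⟩` is a path `p` with tail `i` and head `j`. -/
abbrev QPath (V : Type) [Quiver.{0} V] : Type := Σ i : V, Σ j : V, Quiver.Path i j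

/-- The path algebra `kQ`: formal `k`-linear combinations of paths. -/
def PathAlgebra (k : Type u) (V : Type) [Quiver.{0} V] [Field k] : Type u := QPath V →₀ k

namespace PathAlgebra

variable (k : Type u) [Field k] {V : Type} [Quiver.{0} V]

instance : AddCommGroup (PathAlgebra k V) := inferInstanceAs (AddCommGroup (QPath V →₀ k))

instance : Module k (PathAlgebra k V) := inferInstanceAs (Module k (QPath V →₀ k))

/-- The basis element of `kQ` given by a path. -/
def ofPath (p : QPath V) : PathAlgebra k V := Finsupp.single p (1 : k)

open Classical in
/-- The product `p * q` of two paths is "`q` followed by `p`" if the head of `q` is the tail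
of `p`, and it is `0` otherwise. -/
def pathMul (p q : QPath V) : PathAlgebra k V :=
  if h : q.2.1 = p.1 then
    ofPath k ⟨q.1, p.2.1, q.2.2.comp (p.2.2.cast h.symm rfl)⟩
  else 0

/-- The bilinear extension of the product of paths. -/
def mulLin : PathAlgebra k V →ₗ[k] PathAlgebra k V →ₗ[k] PathAlgebra k V :=
  Finsupp.linearCombination k fun p : QPath V =>
    (Finsupp.linearCombination k (pathMul k p) : (QPath V →₀ k) →ₗ[k] PathAlgebra k V)

instance : Mul (PathAlgebra k V) := ⟨fun x y => mulLin k x y⟩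

/-- The unit of `kQ` is the sum of the trivial paths `e_i`. -/
instance [Fintype V] : One (PathAlgebra k V) :=
  ⟨∑ i : V, ofPath k ⟨i, i, Quiver.Path.nil⟩⟩

theorem mul_def (x y : PathAlgebra k V) : x * y = mulLin k x y := rfl

theorem one_def [Fintype V] :
    (1 : PathAlgebra k V) = ∑ i : V, ofPath k ⟨i, i, Quiver.Path.nil⟩ := rfl

theorem ofPath_mul_ofPath (p q : QPath V) : ofPath k p * ofPath k q = pathMul k p q := by
  have h₁ : mulLin k (ofPath k p) = (Finsupp.linearCombination k (pathMul k p) :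
      (QPath V →₀ k) →ₗ[k] PathAlgebra k V) :=
    (Finsupp.linearCombination_single k _ _).trans (one_smul k _)
  change mulLin k (ofPath k p) (ofPath k q) = _
  rw [h₁]
  exact (Finsupp.linearCombination_single k _ _).trans (one_smul k _)

theorem pathMul_mk {i j l : V} (p : Quiver.Path i j) (q : Quiver.Path j l) :
    pathMul k ⟨j, l, q⟩ ⟨i, j, p⟩ = ofPath k ⟨i, l, p.comp q⟩ := by
  simp [pathMul]

theorem pathMul_ne (p q : QPath V) (h : q.2.1 ≠ p.1) : pathMul k p q = 0 := by
  simp [pathMul, h]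

variable {k} in
theorem induction_on {P : PathAlgebra k V → Prop} (x : PathAlgebra k V) (h0 : P 0)
    (hadd : ∀ x y, P x → P y → P (x + y)) (hs : ∀ (c : k) (p : QPath V), P (c • ofPath k p)) :
    P x := by
  refine Finsupp.induction_linear (motive := P) x h0 (fun f g => hadd f g) (fun p c => ?_)
  have h := hs c p
  have e : c • ofPath k p = (Finsupp.single p c : QPath V →₀ k) := by
    change c • (Finsupp.single p (1 : k) : QPath V →₀ k) = _
    simp
  rwa [e] at h

theorem ofPath_assoc (p q r : QPath V) :
    ofPath k p * ofPath k q * ofPath k r = ofPath k p * (ofPath k q * ofPath k r) := by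
  obtain ⟨p₁, p₂, p⟩ := p
  obtain ⟨q₁, q₂, q⟩ := q
  obtain ⟨r₁, r₂, r⟩ := r
  by_cases h₁ : q₂ = p₁
  · subst h₁
    by_cases h₂ : r₂ = q₁
    · subst h₂
      simp [ofPath_mul_ofPath, pathMul_mk, Quiver.Path.comp_assoc]
    · rw [ofPath_mul_ofPath, pathMul_mk, ofPath_mul_ofPath, pathMul_ne _ _ _ h₂,
        ofPath_mul_ofPath, pathMul_ne _ _ _ h₂]
      simp [mul_def]
  · by_cases h₂ : r₂ = q₁
    · subst h₂
      rw [ofPath_mul_ofPath k ⟨r₂, q₂, q⟩, pathMul_mk, ofPath_mul_ofPath, pathMul_ne _ _ _ h₁,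
        ofPath_mul_ofPath, pathMul_ne _ _ _ h₁]
      simp [mul_def]
    · rw [ofPath_mul_ofPath, pathMul_ne _ _ _ h₁, ofPath_mul_ofPath, pathMul_ne _ _ _ h₂]
      simp [mul_def]

instance : NonUnitalRing (PathAlgebra k V) where
  left_distrib x y z := by simp [mul_def]
  right_distrib x y z := by simp [mul_def]
  zero_mul x := by simp [mul_def]
  mul_zero x := by simp [mul_def]
  mul_assoc x y z := by
    have hsl : ∀ (c : k) (x y : PathAlgebra k V), (c • x) * y = c • (x * y) := by simp [mul_def]
    have hsr : ∀ (c : k) (x y : PathAlgebra k V), x * (c • y) = c • (x * y) := by simp [mul_def]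
    have hal : ∀ x y z : PathAlgebra k V, (x + y) * z = x * z + y * z := by simp [mul_def]
    have har : ∀ x y z : PathAlgebra k V, x * (y + z) = x * y + x * z := by simp [mul_def]
    have hzl : ∀ x : PathAlgebra k V, 0 * x = 0 := by simp [mul_def]
    have hzr : ∀ x : PathAlgebra k V, x * 0 = 0 := by simp [mul_def]
    induction x using induction_on with
    | h0 => simp [hzl]
    | hadd a b ha hb => simp only [hal, ha, hb]
    | hs c p =>
      induction y using induction_on with
      | h0 => simp [hzl, hzr]
      | hadd a b ha hb => simp only [hal, har, ha, hb]
      | hs d q =>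
        induction z using induction_on with
        | h0 => simp [hzr]
        | hadd a b ha hb => simp only [har, ha, hb]
        | hs e r => simp only [hsl, hsr, ofPath_assoc]

variable [Fintype V]

theorem one_mul_ofPath (p : QPath V) : 1 * ofPath k p = ofPath k p := by
  classical
  obtain ⟨i, j, p⟩ := p
  rw [one_def, Finset.sum_mul, Finset.sum_eq_single j]
  · rw [ofPath_mul_ofPath, pathMul_mk, Quiver.Path.comp_nil]
  · intro l _ hl
    rw [ofPath_mul_ofPath, pathMul_ne _ _ _ (Ne.symm hl)]
  · simp

theorem ofPath_mul_one (p : QPath V) : ofPath k p * 1 = ofPath k p := by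
  classical
  obtain ⟨i, j, p⟩ := p
  rw [one_def, Finset.mul_sum, Finset.sum_eq_single i]
  · rw [ofPath_mul_ofPath, pathMul_mk, Quiver.Path.nil_comp]
  · intro l _ hl
    rw [ofPath_mul_ofPath, pathMul_ne _ _ _ hl]
  · simp

instance : Ring (PathAlgebra k V) :=
  { (inferInstance : NonUnitalRing (PathAlgebra k V)) with
    one := 1
    one_mul := fun x => by
      have hsr : ∀ (c : k) (x y : PathAlgebra k V), x * (c • y) = c • (x * y) := by
        simp [mul_def]
      induction x using induction_on with
      | h0 => exact mul_zero _
      | hadd a b ha hb => rw [mul_add, ha, hb]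
      | hs c p => rw [hsr, one_mul_ofPath]
    mul_one := fun x => by
      have hsl : ∀ (c : k) (x y : PathAlgebra k V), (c • x) * y = c • (x * y) := by
        simp [mul_def]
      induction x using induction_on with
      | h0 => exact zero_mul _
      | hadd a b ha hb => rw [add_mul, ha, hb]
      | hs c p => rw [hsl, ofPath_mul_one] }

instance : Algebra k (PathAlgebra k V) :=
  Algebra.ofModule (fun c x y => by simp [mul_def]) (fun c x y => by simp [mul_def])

end PathAlgebra

section BoundQuiver

variable {k : Type u} [Field k] {V : Type} [Quiver.{0} V] [Fintype V]

/-- The two-sided ideal of `kQ` generated by a set of paths. -/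
def pathIdeal (k : Type u) [Field k] (M : Set (QPath V)) : TwoSidedIdeal (PathAlgebra k V) :=
  TwoSidedIdeal.span (PathAlgebra.ofPath k '' M)

/-- `I` is admissible: `𝒥 ^ m ⊆ I ⊆ 𝒥 ^ 2` for some `m ≥ 2`, where `𝒥` is the arrow ideal
(so that `𝒥 ^ l` is generated by the paths of length `l`). -/
def IsAdmissible (I : TwoSidedIdeal (PathAlgebra k V)) : Prop :=
  I ≤ pathIdeal k {p | p.2.2.length = 2} ∧
    ∃ m : ℕ, 2 ≤ m ∧ pathIdeal k {p | p.2.2.length = m} ≤ I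

/-- `I` is generated by paths of length two. -/
def IsQuadraticMonomial (I : TwoSidedIdeal (PathAlgebra k V)) : Prop :=
  ∃ M : Set (QPath V), (∀ p ∈ M, p.2.2.length = 2) ∧ I = pathIdeal k M

/-- The quotient algebra `kQ / I`. -/
abbrev BoundQuiverAlgebra (I : TwoSidedIdeal (PathAlgebra k V)) : Type u := I.ringCon.Quotient

end BoundQuiver

/-! ### Star quivers -/

/-- The `r + s + 1` vertices of the `(r, s)`-star quiver. -/
inductive StarVertex (r s : ℕ) : Type
  | source (i : Fin r) : StarVertex r s
  | center : StarVertex r s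
  | sink (j : Fin s) : StarVertex r s
  deriving Fintype

/-- The arrows `a_i : i → z` and `b_j : z → j` of the `(r, s)`-star quiver. -/
inductive StarArrow (r s : ℕ) : StarVertex r s → StarVertex r s → Type
  | a (i : Fin r) : StarArrow r s (StarVertex.source i) StarVertex.center
  | b (j : Fin s) : StarArrow r s StarVertex.center (StarVertex.sink j)

instance (r s : ℕ) : Quiver.{0} (StarVertex r s) := ⟨StarArrow r s⟩

/-! ### Global dimension and Hochschild-type extension groups -/

/-- The (left) global dimension of a ring: the supremum of the projective dimensions of its left
modules. -/
def globalDimension (R : Type u) [Ring R] : WithBot ℕ∞ :=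
  ⨆ M : ModuleCat.{u} R, projectiveDimension M

section Enveloping

open scoped TensorProduct

variable (k : Type u) [Field k] (Λ : Type u) [Ring Λ] [Algebra k Λ]

/-- The enveloping algebra `Λ^e = Λ ⊗_k Λ^op`. -/
abbrev Env : Type u := Λ ⊗[k] Λᵐᵒᵖ

/-- `Λ` as a left `Λ^e`-module, `(a ⊗ b) • x = a * x * b`. -/
def regularBimodule : ModuleCat.{u} (Env k Λ) :=
  letI : Module (Env k Λ) Λ := TensorProduct.Algebra.module
  ModuleCat.of (Env k Λ) Λ

/-- `Ext^l_{Λ^e}(Λ, Λ^e)`. -/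
abbrev ExtEnv (l : ℕ) : Type u :=
  Abelian.Ext (regularBimodule k Λ) (ModuleCat.of (Env k Λ) (Env k Λ)) l

end Enveloping

/-! ### The bimodule `DΛ` and the two functors `DΛ ⊗_Λ -` and `Hom_Λ(DΛ, -)` -/

section Dual

variable (k : Type u) [Field k] (Λ : Type u) [Ring Λ] [Algebra k Λ]

/-- The `k`-dual `DΛ = Hom_k(Λ, k)`. -/
def DualBimodule : Type u := Λ →ₗ[k] k

instance : AddCommGroup (DualBimodule k Λ) := inferInstanceAs (AddCommGroup (Λ →ₗ[k] k))

instance : FunLike (DualBimodule k Λ) Λ k := inferInstanceAs (FunLike (Λ →ₗ[k] k) Λ k)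

/-- The left action `(a φ)(x) = φ (x a)`. -/
instance : Module Λ (DualBimodule k Λ) where
  smul a φ := LinearMap.comp (M₂ := Λ) φ (LinearMap.mulRight k a)
  one_smul φ := LinearMap.ext fun x => congrArg φ (mul_one x)
  mul_smul a b φ := LinearMap.ext fun x => congrArg φ (mul_assoc x a b).symm
  smul_zero _ := rfl
  smul_add _ _ _ := rfl
  add_smul a b φ := LinearMap.ext fun x =>
    (congrArg φ (mul_add x a b)).trans (LinearMap.map_add φ _ _)
  zero_smul φ := LinearMap.ext fun x =>
    (congrArg φ (mul_zero x)).trans (LinearMap.map_zero φ)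

/-- The right action `(φ a)(x) = φ (a x)`. -/
instance : Module Λᵐᵒᵖ (DualBimodule k Λ) where
  smul a φ := LinearMap.comp (M₂ := Λ) φ (LinearMap.mulLeft k a.unop)
  one_smul φ := LinearMap.ext fun x => congrArg φ (one_mul x)
  mul_smul a b φ := LinearMap.ext fun x =>
    congrArg φ (mul_assoc b.unop a.unop x)
  smul_zero _ := rfl
  smul_add _ _ _ := rfl
  add_smul a b φ := LinearMap.ext fun x =>
    (congrArg φ (add_mul a.unop b.unop x)).trans (LinearMap.map_add φ _ _)
  zero_smul φ := LinearMap.ext fun x =>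
    (congrArg φ (zero_mul x)).trans (LinearMap.map_zero φ)

theorem smul_apply (a : Λ) (φ : DualBimodule k Λ) (x : Λ) : (a • φ) x = φ (x * a) := rfl

theorem op_smul_apply (a : Λ) (φ : DualBimodule k Λ) (x : Λ) :
    (MulOpposite.op a • φ) x = φ (a * x) := rfl

instance : SMulCommClass Λ Λᵐᵒᵖ (DualBimodule k Λ) where
  smul_comm a b φ := LinearMap.ext fun x => congrArg φ (mul_assoc b.unop x a).symm

end Dual

section Functors

open scoped TensorProduct

variable {Λ : Type u} [Ring Λ] (B : Type u) [AddCommGroup B] [Module Λ B] [Module Λᵐᵒᵖ B]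
  [SMulCommClass Λ Λᵐᵒᵖ B]

/-- The relations `φ a ⊗ m = φ ⊗ a m` which are divided out of `B ⊗_ℤ M` to get `B ⊗_Λ M`. -/
def balancing (M : ModuleCat.{u} Λ) : Submodule Λ (B ⊗[ℤ] M) :=
  Submodule.span Λ {x | ∃ (φ : B) (a : Λ) (m : M),
    x = (MulOpposite.op a • φ) ⊗ₜ[ℤ] m - φ ⊗ₜ[ℤ] (a • m)}

/-- The map `B ⊗_ℤ M → B ⊗_ℤ N` induced by `f : M → N`. -/
def tensorMapAux {M N : ModuleCat.{u} Λ} (f : M ⟶ N) : B ⊗[ℤ] M →ₗ[Λ] B ⊗[ℤ] N :=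
  TensorProduct.AlgebraTensorModule.map (LinearMap.id : B →ₗ[Λ] B) (f.hom.restrictScalars ℤ)

theorem tensorMapAux_tmul {M N : ModuleCat.{u} Λ} (f : M ⟶ N) (φ : B) (m : M) :
    tensorMapAux B f (φ ⊗ₜ[ℤ] m) = φ ⊗ₜ[ℤ] (f.hom m) := rfl

theorem balancing_le_comap {M N : ModuleCat.{u} Λ} (f : M ⟶ N) :
    balancing B M ≤ (balancing B N).comap (tensorMapAux B f) := by
  refine Submodule.span_le.2 ?_
  rintro _ ⟨φ, a, m, rfl⟩
  refine Submodule.subset_span ⟨φ, a, f.hom m, ?_⟩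
  rw [map_sub, tensorMapAux_tmul, tensorMapAux_tmul, map_smul]

theorem quotient_tmul_ext {M : ModuleCat.{u} Λ} {N : Type u} [AddCommGroup N] [Module Λ N]
    {f g : ((B ⊗[ℤ] M) ⧸ balancing B M) →ₗ[Λ] N}
    (h : ∀ φ m, f ((balancing B M).mkQ (φ ⊗ₜ[ℤ] m)) = g ((balancing B M).mkQ (φ ⊗ₜ[ℤ] m))) :
    f = g := by
  refine Submodule.linearMap_qext _ (LinearMap.ext fun x => ?_)
  induction x using TensorProduct.induction_on with
  | zero => simp
  | tmul φ m => exact h φ m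
  | add x y hx hy => rw [map_add, map_add, hx, hy]

/-- The functor `B ⊗_Λ -` on left modules, for a `Λ`-`Λ`-bimodule `B`. -/
def tensorFunctor : ModuleCat.{u} Λ ⥤ ModuleCat.{u} Λ where
  obj M := ModuleCat.of Λ ((B ⊗[ℤ] M) ⧸ balancing B M)
  map {M N} f := ModuleCat.ofHom
    (Submodule.mapQ (balancing B M) (balancing B N) (tensorMapAux B f) (balancing_le_comap B f))
  map_id M := by
    refine ModuleCat.hom_ext (quotient_tmul_ext B fun φ m => ?_)
    rfl
  map_comp f g := by
    refine ModuleCat.hom_ext (quotient_tmul_ext B fun φ m => ?_)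
    rfl

instance : (tensorFunctor (Λ := Λ) B).Additive where
  map_add {M N f g} := by
    refine ModuleCat.hom_ext (quotient_tmul_ext B fun φ m => ?_)
    change (balancing B N).mkQ (φ ⊗ₜ[ℤ] (f.hom m + g.hom m)) =
      (balancing B N).mkQ (φ ⊗ₜ[ℤ] f.hom m) + (balancing B N).mkQ (φ ⊗ₜ[ℤ] g.hom m)
    rw [TensorProduct.tmul_add, map_add]

/-- The group `Hom_Λ(B, M)` of left `Λ`-linear maps, for a `Λ`-`Λ`-bimodule `B`. -/
def BimodHom (B : Type u) [AddCommGroup B] [Module Λ B] (M : Type u) [AddCommGroup M]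
    [Module Λ M] : Type u := B →ₗ[Λ] M

instance (M : Type u) [AddCommGroup M] [Module Λ M] : AddCommGroup (BimodHom (Λ := Λ) B M) :=
  inferInstanceAs (AddCommGroup (B →ₗ[Λ] M))

instance (M : Type u) [AddCommGroup M] [Module Λ M] : FunLike (BimodHom (Λ := Λ) B M) B M :=
  inferInstanceAs (FunLike (B →ₗ[Λ] M) B M)

/-- The left `Λ`-module structure on `Hom_Λ(B, M)`, `(a f)(φ) = f (φ a)`. -/
instance (M : Type u) [AddCommGroup M] [Module Λ M] : Module Λ (BimodHom (Λ := Λ) B M) where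
  smul a f :=
    { toFun := fun φ => f (MulOpposite.op a • φ)
      map_add' := fun φ ψ => by rw [smul_add]; exact LinearMap.map_add f _ _
      map_smul' := fun b φ => by rw [← smul_comm]; exact LinearMap.map_smul f _ _ }
  one_smul f := LinearMap.ext fun φ => congrArg f (one_smul Λᵐᵒᵖ φ)
  mul_smul a b f := LinearMap.ext fun φ =>
    congrArg f (mul_smul (MulOpposite.op b) (MulOpposite.op a) φ)
  smul_zero _ := rfl
  smul_add _ _ _ := rfl
  add_smul a b f := LinearMap.ext fun φ =>
    (congrArg f (add_smul (MulOpposite.op a) (MulOpposite.op b) φ)).trans (LinearMap.map_add f _ _)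
  zero_smul f := LinearMap.ext fun φ =>
    (congrArg f (zero_smul Λᵐᵒᵖ φ)).trans (LinearMap.map_zero f)

/-- The functor `Hom_Λ(B, -)` on left modules, for a `Λ`-`Λ`-bimodule `B`. -/
def homFunctor : ModuleCat.{u} Λ ⥤ ModuleCat.{u} Λ where
  obj M := ModuleCat.of Λ (BimodHom (Λ := Λ) B M)
  map {M N} f := ModuleCat.ofHom (X := BimodHom (Λ := Λ) B M) (Y := BimodHom (Λ := Λ) B N)
    { toFun := fun g => LinearMap.comp (M₂ := M) f.hom g
      map_add' := fun g h => LinearMap.comp_add (M₂ := M) g h f.hom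
      map_smul' := fun _ _ => rfl }
  map_id _ := rfl
  map_comp _ _ := rfl

instance : (homFunctor (Λ := Λ) B).Additive where
  map_add {_ _ _ _} := ModuleCat.hom_ext (LinearMap.ext fun _ => LinearMap.ext fun _ => rfl)

end Functors

/-! ### The Serre functor and `n`-hereditary algebras -/

section Hereditary

attribute [local instance] HasDerivedCategory.standard

variable (k : Type u) [Field k] (Λ : Type u) [Ring Λ] [Algebra k Λ]

/-- `K` is a bounded complex of finitely generated `Λ`-modules all of which satisfy `P`. -/
def IsBoundedComplexOf {Λ : Type u} [Ring Λ] (P : ModuleCat.{u} Λ → Prop)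
    (K : CochainComplex (ModuleCat.{u} Λ) ℤ) : Prop :=
  (∀ n, P (K.X n) ∧ Module.Finite Λ (K.X n)) ∧
    ∃ N : ℤ, ∀ n, N < |n| → Limits.IsZero (K.X n)

/-- `Y ≅ 𝕊 X`, where `𝕊 = DΛ ⊗^𝐋_Λ -` is computed by means of a bounded complex of finitely
generated projective modules isomorphic to `X` in the derived category. If `Λ` is
finite-dimensional of finite global dimension, then every object of `D^b(mod Λ)` is isomorphic
to such a complex. -/
def IsSerre (X Y : DerivedCategory (ModuleCat.{u} Λ)) : Prop :=
  ∃ P : CochainComplex (ModuleCat.{u} Λ) ℤ, IsBoundedComplexOf (fun M => Projective M) P ∧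
    Nonempty (DerivedCategory.Q.obj P ≅ X) ∧
    Nonempty (DerivedCategory.Q.obj
      (((tensorFunctor (Λ := Λ) (DualBimodule k Λ)).mapHomologicalComplex _).obj P) ≅ Y)

/-- `Y ≅ 𝕊⁻¹ X`, where `𝕊⁻¹ = 𝐑Hom_Λ(DΛ, -)` is computed by means of a bounded complex of
finitely generated injective modules isomorphic to `X` in the derived category. If `Λ` is
finite-dimensional of finite global dimension, then every object of `D^b(mod Λ)` is isomorphic
to such a complex. -/
def IsSerreInv (X Y : DerivedCategory (ModuleCat.{u} Λ)) : Prop :=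
  ∃ I : CochainComplex (ModuleCat.{u} Λ) ℤ, IsBoundedComplexOf (fun M => Injective M) I ∧
    Nonempty (DerivedCategory.Q.obj I ≅ X) ∧
    Nonempty (DerivedCategory.Q.obj
      (((homFunctor (Λ := Λ) (DualBimodule k Λ)).mapHomologicalComplex _).obj I) ≅ Y)

/-- The family `X i ≅ 𝕊 ^ i Λ`, `i ∈ ℤ`, of objects of `D^b(mod Λ)`; it is determined up to
isomorphism. -/
structure IsSerreOrbit (X : ℤ → DerivedCategory (ModuleCat.{u} Λ)) : Prop where
  zero : Nonempty (X 0 ≅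
    (DerivedCategory.singleFunctor (ModuleCat.{u} Λ) 0).obj (ModuleCat.of Λ Λ))
  succ : ∀ i : ℕ, IsSerre k Λ (X i) (X (i + 1))
  pred : ∀ i : ℕ, IsSerreInv k Λ (X (-i)) (X (-i - 1))

/-- `Λ` is `n`-hereditary: it is a finite-dimensional algebra of global dimension `n`, and
`H^j(𝕊_n ^ i Λ) = 0` for all `i, j ∈ ℤ` with `j ∉ n ℤ`, where `𝕊_n = 𝕊 ∘ [-n]`, so that
`𝕊_n ^ i Λ = (𝕊 ^ i Λ)[-n i]`. -/
def IsNHereditary (n : ℕ) : Prop :=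
  Module.Finite k Λ ∧ globalDimension Λ = n ∧
    ∃ X : ℤ → DerivedCategory (ModuleCat.{u} Λ), IsSerreOrbit k Λ X ∧
      ∀ i j : ℤ, ¬ (n : ℤ) ∣ j →
        Limits.IsZero ((DerivedCategory.homologyFunctor (ModuleCat.{u} Λ) j).obj
          ((shiftFunctor (DerivedCategory (ModuleCat.{u} Λ)) (-(n * i))).obj (X i)))

end Hereditary

end StarCor

end

/-! The vanishing of Ext¹ in (1) and of cohomology in (2) enter only through a common consequence,
`DerivationsInner`. A derivation D of Λ into the outer bimodule Λ ⊗ Λ becomes, on contracting the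
second factor with functionals, a derivation into Hom_k(DΛ, Λ), and it is there that D has to be
inner. If Ext¹ over Λ^e vanishes, D is inner already in Λ ⊗ Λ, because it defines a Λ^e-linear map
on the kernel of multiplication, which extends to Λ^e (`derivationsInner_of_subsingleton_ext`). If Λ
is 2-hereditary, H^{-1}(𝕊₂^{-1}Λ) = Ext¹_Λ(DΛ, Λ) vanishes, so the extension of DΛ by Λ twisted by D
splits, and a splitting exhibits D as inner (`exists_retraction`,
`derivationsInner_of_retractions`).

The shape of Q is then read off from derivations supported on a single arrow a : i → j; in products,
ba means a followed by b. If a lay in no relation, a ↦ e_j ⊗ e_i would be a derivation that is not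
inner, so every arrow lies in a relation (`exists_relation`). If a is the last arrow of no relation,
a ↦ a ⊗ e_i is a derivation, and its being inner makes i a source from which only a starts
(`isLeafSource_of_relation`). Dually, a ↦ e_j ⊗ a treats an arrow that is the first of no relation
(`isLeafSink_of_relation`).

Global dimension at most two makes the left annihilator of an arrow projective, which forbids ac = 0
and ba = 0 together (`mul_ne_zero_of_mul_eq_zero`). So no arrow is both first and last in relations,
and each arrow has a leaf at its tail or head. An arrow exists, as a point has global dimension
zero; the relation through it gives a path of length two, and by connectedness everything else hangs
on its middle vertex (`nonempty_iso_star`). Finally the relations are carried along the isomorphism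
of quivers. -/

noncomputable section

namespace StarCor

open PathAlgebra
open scoped TensorProduct

/-! ### Coefficients of paths of length at most one -/

section Coefficients

variable (k : Type u) [Field k] {V : Type} [Quiver.{0} V]

/-- The trivial path at `i`. -/
abbrev trivialPath (i : V) : QPath V := ⟨i, i, Quiver.Path.nil⟩

/-- An arrow, as a path. -/
abbrev arrowPath {i j : V} (a : i ⟶ j) : QPath V := ⟨i, j, a.toPath⟩

/-- The coefficient of a path in an element of the path algebra. -/
def pathCoeff (p : QPath V) : PathAlgebra k V →ₗ[k] k :=
  (Finsupp.lapply p : (QPath V →₀ k) →ₗ[k] k)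

open Classical in
theorem pathCoeff_ofPath (p q : QPath V) :
    pathCoeff k p (ofPath k q) = if q = p then 1 else 0 :=
  Finsupp.single_apply

theorem pathCoeff_ofPath_self (p : QPath V) : pathCoeff k p (ofPath k p) = 1 := by
  simp [pathCoeff_ofPath]

theorem pathCoeff_ofPath_of_length_ne {p q : QPath V} (h : q.2.2.length ≠ p.2.2.length) :
    pathCoeff k p (ofPath k q) = 0 := by
  rw [pathCoeff_ofPath, if_neg]
  rintro rfl
  exact h rfl

/-- Paths form a basis. The maps are left unbundled so that product formulas can be substituted
directly. -/
theorem bilinear_ext {N : Type*} [AddCommGroup N] [Module k N]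
    {f g : PathAlgebra k V → PathAlgebra k V → N}
    (f_add_left : ∀ x y z, f (x + y) z = f x z + f y z)
    (f_add_right : ∀ x y z, f x (y + z) = f x y + f x z)
    (f_smul_left : ∀ (c : k) x y, f (c • x) y = c • f x y)
    (f_smul_right : ∀ (c : k) x y, f x (c • y) = c • f x y)
    (g_add_left : ∀ x y z, g (x + y) z = g x z + g y z)
    (g_add_right : ∀ x y z, g x (y + z) = g x y + g x z)
    (g_smul_left : ∀ (c : k) x y, g (c • x) y = c • g x y)
    (g_smul_right : ∀ (c : k) x y, g x (c • y) = c • g x y)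
    (h : ∀ p q, f (ofPath k p) (ofPath k q) = g (ofPath k p) (ofPath k q)) (x y) :
    f x y = g x y := by
  have zl : ∀ y, f 0 y = g 0 y := fun y => by
    have h₁ := f_smul_left 0 0 y
    have h₂ := g_smul_left 0 0 y
    rw [zero_smul, zero_smul] at h₁ h₂
    rw [h₁, h₂]
  have zr : ∀ x, f x 0 = g x 0 := fun x => by
    have h₁ := f_smul_right 0 x 0
    have h₂ := g_smul_right 0 x 0
    rw [zero_smul, zero_smul] at h₁ h₂
    rw [h₁, h₂]
  induction x using PathAlgebra.induction_on with
  | h0 => exact zl y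
  | hadd a b ha hb => rw [f_add_left, g_add_left, ha, hb]
  | hs c p =>
    induction y using PathAlgebra.induction_on with
    | h0 => exact zr _
    | hadd a b ha hb => rw [f_add_right, g_add_right, ha, hb]
    | hs d q => rw [f_smul_left, f_smul_right, g_smul_left, g_smul_right, h]

theorem smul_mul_path (c : k) (x y : PathAlgebra k V) : (c • x) * y = c • (x * y) := by
  simp [mul_def]

theorem mul_smul_path (c : k) (x y : PathAlgebra k V) : x * (c • y) = c • (x * y) := by
  simp [mul_def]

theorem pathCoeff_trivialPath_mul (i : V) (x y : PathAlgebra k V) :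
    pathCoeff k (trivialPath i) (x * y) =
      pathCoeff k (trivialPath i) x * pathCoeff k (trivialPath i) y := by
  refine bilinear_ext k (f := fun x y => pathCoeff k (trivialPath i) (x * y))
    (g := fun x y => pathCoeff k (trivialPath i) x * pathCoeff k (trivialPath i) y)
    ?_ ?_ ?_ ?_ ?_ ?_ ?_ ?_ ?_ x y
  any_goals
    intros; simp [add_mul, mul_add, smul_mul_path, mul_smul_path, mul_assoc, mul_left_comm]
  rintro ⟨p₁, p₂, p⟩ ⟨q₁, q₂, q⟩
  rw [ofPath_mul_ofPath]
  by_cases h : q₂ = p₁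
  · subst h
    rw [pathMul_mk]
    cases p with
    | nil =>
      cases q with
      | nil => by_cases hi : p₂ = i <;> simp [pathCoeff_ofPath, hi]
      | cons q b =>
        rw [pathCoeff_ofPath_of_length_ne, pathCoeff_ofPath_of_length_ne k (q := ⟨_, _, q.cons b⟩),
          mul_zero] <;> simp
    | cons p a =>
      rw [pathCoeff_ofPath_of_length_ne, pathCoeff_ofPath_of_length_ne k (q := ⟨_, _, p.cons a⟩),
          zero_mul] <;> simp
  · rw [pathMul_ne _ _ _ h, map_zero]
    rw [pathCoeff_ofPath, pathCoeff_ofPath]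
    split_ifs with h₁ h₂ <;> try simp
    cases h₁; cases h₂; exact absurd rfl h

/-- An arrow factors into two paths in only two ways, with the trivial path at its tail or at its
head. This Leibniz-type rule is what makes all later computations possible without a normal form in
the quotient. -/
theorem pathCoeff_arrowPath_mul {i j : V} (a : i ⟶ j) (x y : PathAlgebra k V) :
    pathCoeff k (arrowPath a) (x * y) =
      pathCoeff k (arrowPath a) x * pathCoeff k (trivialPath i) y +
        pathCoeff k (trivialPath j) x * pathCoeff k (arrowPath a) y := by
  refine bilinear_ext k (f := fun x y => pathCoeff k (arrowPath a) (x * y))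
    (g := fun x y => pathCoeff k (arrowPath a) x * pathCoeff k (trivialPath i) y +
        pathCoeff k (trivialPath j) x * pathCoeff k (arrowPath a) y)
    ?_ ?_ ?_ ?_ ?_ ?_ ?_ ?_ ?_ x y
  any_goals
    intros; simp [add_mul, mul_add, smul_mul_path, mul_smul_path]; try ring
  rintro ⟨p₁, p₂, p⟩ ⟨q₁, q₂, q⟩
  rw [ofPath_mul_ofPath]
  have key : ∀ (s t : QPath V), s.2.2.length + t.2.2.length ≠ 1 →
      pathCoeff k (arrowPath a) (ofPath k s) * pathCoeff k (trivialPath i) (ofPath k t) = 0 := by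
    intro s t hst
    by_cases h : s.2.2.length = 1
    · rw [pathCoeff_ofPath_of_length_ne k (p := trivialPath i), mul_zero]
      simp only [Quiver.Path.length_nil]
      omega
    · rw [pathCoeff_ofPath_of_length_ne k (p := arrowPath a), zero_mul]
      simpa using h
  have key' : ∀ (s t : QPath V), s.2.2.length + t.2.2.length ≠ 1 →
      pathCoeff k (trivialPath j) (ofPath k s) * pathCoeff k (arrowPath a) (ofPath k t) = 0 := by
    intro s t hst
    by_cases h : t.2.2.length = 1
    · rw [pathCoeff_ofPath_of_length_ne k (p := trivialPath j), zero_mul]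
      simp only [Quiver.Path.length_nil]
      omega
    · rw [pathCoeff_ofPath_of_length_ne k (p := arrowPath a), mul_zero]
      simpa using h
  by_cases h : q₂ = p₁
  · subst h
    rw [pathMul_mk]
    by_cases hl : p.length + q.length = 1
    · cases p with
      | nil =>
        have h0 : pathCoeff k (arrowPath a) (ofPath k (trivialPath p₂)) = 0 :=
          pathCoeff_ofPath_of_length_ne k (by simp)
        rw [h0, zero_mul, zero_add, Quiver.Path.comp_nil]
        by_cases hj : p₂ = j
        · subst hj
          rw [pathCoeff_ofPath_self, one_mul]
        · rw [pathCoeff_ofPath, if_neg, pathCoeff_ofPath k _ (trivialPath p₂), if_neg, zero_mul]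
          · intro h; cases h; exact hj rfl
          · intro h; cases h; exact hj rfl
      | cons p b =>
        have hp : p.length = 0 := by simp at hl; omega
        have hq : q.length = 0 := by simp at hl; omega
        cases q with
        | cons q c => simp at hq
        | nil =>
          have h0 : pathCoeff k (arrowPath a) (ofPath k (trivialPath q₁)) = 0 :=
            pathCoeff_ofPath_of_length_ne k (by simp)
          rw [h0, mul_zero, add_zero, Quiver.Path.nil_comp]
          by_cases hj : q₁ = i
          · subst hj
            rw [pathCoeff_ofPath_self, mul_one]
          · rw [pathCoeff_ofPath, if_neg, pathCoeff_ofPath k _ (trivialPath q₁), if_neg, mul_zero]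
            · intro h; cases h; exact hj rfl
            · intro h; cases h; exact hj rfl
    · rw [key _ _ hl, key' _ _ hl, add_zero]
      apply pathCoeff_ofPath_of_length_ne
      simp only [Quiver.Path.length_comp, Quiver.Path.length_toPath]
      omega
  · rw [pathMul_ne _ _ _ h, map_zero]
    simp only [pathCoeff_ofPath]
    -- Two paths matching both factors of either summand would be composable.
    have h₁ : ¬ ((⟨p₁, p₂, p⟩ : QPath V) = arrowPath a ∧
        (⟨q₁, q₂, q⟩ : QPath V) = trivialPath i) := by
      rintro ⟨h₁, h₂⟩; cases h₁; cases h₂; exact h rfl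
    have h₂ : ¬ ((⟨p₁, p₂, p⟩ : QPath V) = trivialPath j ∧
        (⟨q₁, q₂, q⟩ : QPath V) = arrowPath a) := by
      rintro ⟨h₁, h₂⟩; cases h₁; cases h₂; exact h rfl
    by_cases e₁ : (⟨p₁, p₂, p⟩ : QPath V) = arrowPath a
    · rw [if_neg (fun e => h₁ ⟨e₁, e⟩), mul_zero, zero_add]
      by_cases e₂ : (⟨p₁, p₂, p⟩ : QPath V) = trivialPath j
      · rw [if_neg (fun e => h₂ ⟨e₂, e⟩), mul_zero]
      · rw [if_neg e₂, zero_mul]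
    · rw [if_neg e₁, zero_mul, zero_add]
      by_cases e₂ : (⟨p₁, p₂, p⟩ : QPath V) = trivialPath j
      · rw [if_neg (fun e => h₂ ⟨e₂, e⟩), mul_zero]
      · rw [if_neg e₂, zero_mul]

/-- Elements of the ideal generated by the paths of length two have no terms of length at most
one. -/
theorem pathCoeff_eq_zero_of_mem [Fintype V] {x : PathAlgebra k V}
    (hx : x ∈ pathIdeal k {p : QPath V | p.2.2.length = 2}) :
    (∀ i, pathCoeff k (trivialPath i) x = 0) ∧
      ∀ (i j : V) (a : i ⟶ j), pathCoeff k (arrowPath a) x = 0 := by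
  -- By the product formulas, vanishing of all these coefficients defines a two-sided ideal, so only
  -- the generators need to be tested.
  let K : TwoSidedIdeal (PathAlgebra k V) := TwoSidedIdeal.mk'
    {x | (∀ i, pathCoeff k (trivialPath i) x = 0) ∧
      ∀ (i j : V) (a : i ⟶ j), pathCoeff k (arrowPath a) x = 0}
    ⟨fun i => map_zero _, fun i j a => map_zero _⟩
    (fun {x y} hx hy => ⟨fun i => by rw [map_add, hx.1, hy.1, add_zero],
      fun i j a => by rw [map_add, hx.2, hy.2, add_zero]⟩)
    (fun {x} hx => ⟨fun i => by rw [map_neg, hx.1, neg_zero],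
      fun i j a => by rw [map_neg, hx.2, neg_zero]⟩)
    (fun {x y} hy => ⟨fun i => by rw [pathCoeff_trivialPath_mul, hy.1, mul_zero],
      fun i j a => by rw [pathCoeff_arrowPath_mul, hy.1, hy.2, mul_zero, mul_zero, add_zero]⟩)
    (fun {x y} hx => ⟨fun i => by rw [pathCoeff_trivialPath_mul, hx.1, zero_mul],
      fun i j a => by rw [pathCoeff_arrowPath_mul, hx.1, hx.2, zero_mul, zero_mul, add_zero]⟩)
  have hK : pathIdeal k {p : QPath V | p.2.2.length = 2} ≤ K := by
    refine TwoSidedIdeal.span_le.2 ?_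
    rintro _ ⟨p, hp, rfl⟩
    refine (TwoSidedIdeal.mem_mk' _ _ _ _ _ _ _).2 ⟨fun i => ?_, fun i j a => ?_⟩
    · exact pathCoeff_ofPath_of_length_ne k (by rw [hp]; simp)
    · exact pathCoeff_ofPath_of_length_ne k (by rw [hp]; simp)
  have h := hK hx
  rwa [TwoSidedIdeal.mem_mk'] at h

end Coefficients

/-! ### Coefficient functionals on the bound quiver algebra -/

section Quotient

variable {k : Type u} [Field k] {V : Type} [Quiver.{0} V] [Fintype V]
  (I : TwoSidedIdeal (PathAlgebra k V))

/-- The projection of the path algebra onto a bound quiver algebra. -/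
def proj : PathAlgebra k V →ₐ[k] BoundQuiverAlgebra I := I.ringCon.mkₐ k

theorem proj_surjective : Function.Surjective (proj I) := I.ringCon.mk'_surjective

theorem proj_eq_zero_iff {x : PathAlgebra k V} : proj I x = 0 ↔ x ∈ I := by
  rw [TwoSidedIdeal.mem_iff, ← RingCon.eq]
  rfl

/-- A linear map on the path algebra which vanishes on `I` descends to the quotient. -/
def descend {N : Type*} [AddCommGroup N] [Module k N] (f : PathAlgebra k V →ₗ[k] N)
    (hf : ∀ x ∈ I, f x = 0) : BoundQuiverAlgebra I →ₗ[k] N :=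
  (Submodule.liftQ (LinearMap.ker (proj I).toLinearMap) f
    (fun x hx => hf x ((proj_eq_zero_iff I).1 hx))).comp
    (LinearMap.quotKerEquivOfSurjective (proj I).toLinearMap (proj_surjective I)).symm.toLinearMap

theorem descend_proj {N : Type*} [AddCommGroup N] [Module k N] (f : PathAlgebra k V →ₗ[k] N)
    (hf : ∀ x ∈ I, f x = 0) (x : PathAlgebra k V) : descend I f hf (proj I x) = f x := by
  have h : (LinearMap.quotKerEquivOfSurjective (proj I).toLinearMap (proj_surjective I)).symm
      (proj I x) = Submodule.Quotient.mk x := by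
    rw [LinearEquiv.symm_apply_eq]
    rfl
  rw [descend, LinearMap.comp_apply, LinearEquiv.coe_coe, h]
  rfl

/-- The class of the trivial path at `i`. -/
def vertexElt (i : V) : BoundQuiverAlgebra I := proj I (ofPath k (trivialPath i))

/-- The class of an arrow. -/
def arrowElt {i j : V} (a : i ⟶ j) : BoundQuiverAlgebra I := proj I (ofPath k (arrowPath a))

variable {I}

theorem arrowElt_mul_vertexElt {i j : V} (a : i ⟶ j) :
    arrowElt I a * vertexElt I i = arrowElt I a := by
  rw [arrowElt, vertexElt, ← map_mul, ofPath_mul_ofPath, pathMul_mk, Quiver.Path.nil_comp]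

theorem vertexElt_mul_arrowElt {i j : V} (a : i ⟶ j) :
    vertexElt I j * arrowElt I a = arrowElt I a := by
  rw [arrowElt, vertexElt, ← map_mul, ofPath_mul_ofPath, pathMul_mk, Quiver.Path.comp_nil]

theorem vertexElt_mul_self (i : V) : vertexElt I i * vertexElt I i = vertexElt I i := by
  rw [vertexElt, ← map_mul, ofPath_mul_ofPath, pathMul_mk, Quiver.Path.comp_nil]

/-- The path of length two given by two composable arrows. -/
abbrev arrowPath₂ {i j l : V} (a : i ⟶ j) (b : j ⟶ l) : QPath V := ⟨i, l, a.toPath.cons b⟩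

theorem arrowElt_mul_arrowElt {i j l : V} (a : i ⟶ j) (b : j ⟶ l) :
    arrowElt I b * arrowElt I a = proj I (ofPath k (arrowPath₂ a b)) := by
  rw [arrowElt, arrowElt, ← map_mul, ofPath_mul_ofPath, pathMul_mk]
  rfl

variable (hI : I ≤ pathIdeal k {p : QPath V | p.2.2.length = 2})

/-- The coefficient of the trivial path at `i`, on a bound quiver algebra. -/
def vertexCoeff (i : V) : BoundQuiverAlgebra I →ₗ[k] k :=
  descend I (pathCoeff k (trivialPath i)) fun _ hx => (pathCoeff_eq_zero_of_mem k (hI hx)).1 i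

/-- The coefficient of an arrow, on a bound quiver algebra. -/
def arrowCoeff {i j : V} (a : i ⟶ j) : BoundQuiverAlgebra I →ₗ[k] k :=
  descend I (pathCoeff k (arrowPath a)) fun _ hx => (pathCoeff_eq_zero_of_mem k (hI hx)).2 i j a

theorem vertexCoeff_mul (i : V) (x y : BoundQuiverAlgebra I) :
    vertexCoeff hI i (x * y) = vertexCoeff hI i x * vertexCoeff hI i y := by
  obtain ⟨x, rfl⟩ := proj_surjective I x
  obtain ⟨y, rfl⟩ := proj_surjective I y
  rw [← map_mul, vertexCoeff, descend_proj, descend_proj, descend_proj, pathCoeff_trivialPath_mul]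

theorem arrowCoeff_mul {i j : V} (a : i ⟶ j) (x y : BoundQuiverAlgebra I) :
    arrowCoeff hI a (x * y) =
      arrowCoeff hI a x * vertexCoeff hI i y + vertexCoeff hI j x * arrowCoeff hI a y := by
  obtain ⟨x, rfl⟩ := proj_surjective I x
  obtain ⟨y, rfl⟩ := proj_surjective I y
  rw [← map_mul, vertexCoeff, vertexCoeff, arrowCoeff, descend_proj, descend_proj, descend_proj,
    descend_proj, descend_proj, pathCoeff_arrowPath_mul]

theorem vertexCoeff_vertexElt_self (i : V) : vertexCoeff hI i (vertexElt I i) = 1 := by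
  rw [vertexCoeff, vertexElt, descend_proj, pathCoeff_ofPath_self]

theorem vertexCoeff_arrowElt (l : V) {i j : V} (a : i ⟶ j) :
    vertexCoeff hI l (arrowElt I a) = 0 := by
  rw [vertexCoeff, arrowElt, descend_proj]
  exact pathCoeff_ofPath_of_length_ne k (by simp)

theorem arrowCoeff_vertexElt (l : V) {i j : V} (a : i ⟶ j) :
    arrowCoeff hI a (vertexElt I l) = 0 := by
  rw [arrowCoeff, vertexElt, descend_proj]
  exact pathCoeff_ofPath_of_length_ne k (by simp)

theorem arrowCoeff_arrowElt_self {i j : V} (a : i ⟶ j) :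
    arrowCoeff hI a (arrowElt I a) = 1 := by
  rw [arrowCoeff, arrowElt, descend_proj, pathCoeff_ofPath_self]

end Quotient

/-! ### Derivations into Λ ⊗ Λ and contraction with functionals -/

section Enveloping

variable (k : Type u) [Field k] {Λ : Type u} [Ring Λ] [Algebra k Λ]

/-- The element `x ⊗ 1` of the enveloping algebra. -/
def envLeft (x : Λ) : Env k Λ := x ⊗ₜ[k] (1 : Λᵐᵒᵖ)

/-- The element `1 ⊗ x` of the enveloping algebra. -/
def envRight (x : Λ) : Env k Λ := (1 : Λ) ⊗ₜ[k] MulOpposite.op x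

theorem envLeft_mul (x y : Λ) : envLeft k (x * y) = envLeft k x * envLeft k y := by
  simp [envLeft]

theorem envRight_mul (x y : Λ) : envRight k (x * y) = envRight k y * envRight k x := by
  simp [envRight]

theorem envLeft_mul_envRight (x y : Λ) :
    envLeft k x * envRight k y = envRight k y * envLeft k x := by
  simp [envLeft, envRight]

theorem envLeft_add (x y : Λ) : envLeft k (x + y) = envLeft k x + envLeft k y :=
  TensorProduct.add_tmul _ _ _

theorem envRight_add (x y : Λ) : envRight k (x + y) = envRight k x + envRight k y := by
  simp [envRight, TensorProduct.tmul_add]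

theorem envLeft_smul (c : k) (x : Λ) : envLeft k (c • x) = c • envLeft k x := rfl

theorem envRight_smul (c : k) (x : Λ) : envRight k (c • x) = c • envRight k x := by
  simp [envRight]

theorem envLeft_zero : envLeft k (0 : Λ) = 0 := by simp [envLeft]

theorem envRight_zero : envRight k (0 : Λ) = 0 := by simp [envRight]

theorem envLeft_one : envLeft k (1 : Λ) = 1 := rfl

theorem envRight_one : envRight k (1 : Λ) = 1 := rfl

/-- `D` is a derivation of `Λ` with values in the outer bimodule `Λ ⊗ Λ`. -/
def IsDerivation (D : Λ →ₗ[k] Env k Λ) : Prop :=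
  ∀ x y, D (x * y) = envLeft k x * D y + envRight k y * D x

variable {k}

theorem IsDerivation.map_one {D : Λ →ₗ[k] Env k Λ} (hD : IsDerivation k D) : D 1 = 0 := by
  have h := hD 1 1
  rw [envLeft_one, envRight_one, one_mul, one_mul] at h
  exact left_eq_add.1 h

/-- Contraction of the second tensor factor by a functional. -/
def contract (φ : DualBimodule k Λ) : Env k Λ →ₗ[k] Λ :=
  TensorProduct.lift (LinearMap.flip
    (((LinearMap.lsmul k Λ).comp (show Λ →ₗ[k] k from φ)).comp
      (MulOpposite.opLinearEquiv k).symm.toLinearMap))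

theorem contract_tmul (φ : DualBimodule k Λ) (u : Λ) (v : Λᵐᵒᵖ) :
    contract φ (u ⊗ₜ[k] v) = φ v.unop • u := rfl

theorem contract_envLeft_mul (φ : DualBimodule k Λ) (x : Λ) (n : Env k Λ) :
    contract φ (envLeft k x * n) = x * contract φ n := by
  induction n using TensorProduct.induction_on with
  | zero => simp
  | tmul u v =>
    rw [envLeft, Algebra.TensorProduct.tmul_mul_tmul, contract_tmul, contract_tmul, one_mul,
      mul_smul_comm]
  | add a b ha hb => rw [mul_add, map_add, ha, hb, map_add, mul_add]

/-- On u ⊗ v both sides are φ(vx) u: the outer right action becomes the left action on DΛ. Hence the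
commutator form x h(φ) − h(xφ) of an inner derivation. -/
theorem contract_envRight_mul (φ : DualBimodule k Λ) (x : Λ) (n : Env k Λ) :
    contract φ (envRight k x * n) = contract (x • φ) n := by
  induction n using TensorProduct.induction_on with
  | zero => simp
  | tmul u v =>
    rw [envRight, Algebra.TensorProduct.tmul_mul_tmul, contract_tmul, contract_tmul, one_mul]
    rfl
  | add a b ha hb => rw [mul_add, map_add, ha, hb, map_add]

theorem contract_add (φ ψ : DualBimodule k Λ) (n : Env k Λ) :
    contract (φ + ψ) n = contract φ n + contract ψ n := by
  induction n using TensorProduct.induction_on with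
  | zero => simp
  | tmul u v => exact add_smul (φ v.unop) (ψ v.unop) u
  | add a b ha hb => rw [map_add, map_add, map_add, ha, hb]; abel

theorem contract_zero (n : Env k Λ) : contract (0 : DualBimodule k Λ) n = 0 := by
  have h₀ := contract_add (0 : DualBimodule k Λ) 0 n
  rw [add_zero] at h₀
  exact left_eq_add.1 h₀

variable (k Λ) in
/-- All derivations with values in `Λ ⊗ Λ`, viewed inside `Hom_k (DΛ, Λ)`, are inner. -/
def DerivationsInner : Prop :=
  ∀ D : Λ →ₗ[k] Env k Λ, IsDerivation k D →
    ∃ h : DualBimodule k Λ →+ Λ, ∀ x φ, contract φ (D x) = x * h φ - h (x • φ)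

end Enveloping

/-! ### Derivations with prescribed values on the arrows -/

section Construction

variable {k : Type u} [Field k] {V : Type} [Quiver.{0} V] [Fintype V]
  {I : TwoSidedIdeal (PathAlgebra k V)}
  (δ : ∀ {i j : V}, (i ⟶ j) → Env k (BoundQuiverAlgebra I))

/-- The value on a path of the derivation with prescribed values on the arrows. -/
def pathDerivation {i : V} : ∀ {j : V}, Quiver.Path i j → Env k (BoundQuiverAlgebra I)
  | _, .nil => 0
  | _, @Quiver.Path.cons _ _ _ l _ p b =>
    envLeft k (arrowElt I b) * pathDerivation p +
      envRight k (proj I (ofPath k ⟨i, l, p⟩)) * δ b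

variable {δ}

theorem proj_cons {i j l : V} (p : Quiver.Path i j) (b : j ⟶ l) :
    proj I (ofPath k ⟨i, l, p.cons b⟩) = arrowElt I b * proj I (ofPath k ⟨i, j, p⟩) := by
  rw [arrowElt, ← map_mul, ofPath_mul_ofPath, pathMul_mk]
  rfl

theorem proj_mul_vertexElt {i j : V} (p : Quiver.Path i j) :
    proj I (ofPath k ⟨i, j, p⟩) * vertexElt I i = proj I (ofPath k ⟨i, j, p⟩) := by
  rw [vertexElt, ← map_mul, ofPath_mul_ofPath, pathMul_mk, Quiver.Path.nil_comp]

theorem envLeft_mul_pathDerivation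
    (hδ : ∀ {i j : V} (a : i ⟶ j), envLeft k (vertexElt I j) * δ a = δ a) {i j : V}
    (p : Quiver.Path i j) :
    envLeft k (vertexElt I j) * pathDerivation δ p = pathDerivation δ p := by
  cases p with
  | nil => rw [pathDerivation, mul_zero]
  | cons p b =>
    rw [pathDerivation, mul_add, ← mul_assoc, ← envLeft_mul, vertexElt_mul_arrowElt,
      ← mul_assoc, envLeft_mul_envRight, mul_assoc (envRight k _), hδ]

theorem envRight_mul_pathDerivation {i j : V} (p : Quiver.Path i j) :
    envRight k (vertexElt I i) * pathDerivation δ p = pathDerivation δ p := by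
  induction p with
  | nil => rw [pathDerivation, mul_zero]
  | cons p b ih =>
    rw [pathDerivation, mul_add, ← mul_assoc, ← envLeft_mul_envRight, mul_assoc, ih,
      ← mul_assoc, ← envRight_mul, proj_mul_vertexElt]

/-- Induction on the second path. The condition on δ is needed when that path is trivial, where its
idempotent must fix the value on p. -/
theorem pathDerivation_comp
    (hδ : ∀ {i j : V} (a : i ⟶ j), envLeft k (vertexElt I j) * δ a = δ a) {i j l : V}
    (p : Quiver.Path i j) (q : Quiver.Path j l) :
    pathDerivation δ (p.comp q) =
      envLeft k (proj I (ofPath k ⟨j, l, q⟩)) * pathDerivation δ p +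
        envRight k (proj I (ofPath k ⟨i, j, p⟩)) * pathDerivation δ q := by
  induction q with
  | nil =>
    rw [Quiver.Path.comp_nil, pathDerivation, mul_zero, add_zero]
    exact (envLeft_mul_pathDerivation hδ p).symm
  | cons q b ih =>
    have h : proj I (ofPath k ⟨i, _, p.comp q⟩) =
        proj I (ofPath k ⟨_, _, q⟩) * proj I (ofPath k ⟨_, _, p⟩) := by
      rw [← map_mul, ofPath_mul_ofPath, pathMul_mk]
    rw [Quiver.Path.comp_cons, pathDerivation, ih, pathDerivation, proj_cons, h, envLeft_mul,
      envRight_mul, mul_add, mul_add, ← mul_assoc, ← mul_assoc, ← mul_assoc, ← mul_assoc,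
      envLeft_mul_envRight, add_assoc]

variable (δ) in
/-- The derivation of the path algebra with prescribed values on the arrows. -/
def pathAlgebraDerivation : PathAlgebra k V →ₗ[k] Env k (BoundQuiverAlgebra I) :=
  (Finsupp.linearCombination k fun p : QPath V => pathDerivation δ p.2.2 :
    (QPath V →₀ k) →ₗ[k] Env k (BoundQuiverAlgebra I))

theorem pathAlgebraDerivation_ofPath (p : QPath V) :
    pathAlgebraDerivation δ (ofPath k p) = pathDerivation δ p.2.2 :=
  (Finsupp.linearCombination_single k _ _).trans (one_smul k _)

theorem pathAlgebraDerivation_mul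
    (hl : ∀ {i j : V} (a : i ⟶ j), envLeft k (vertexElt I j) * δ a = δ a)
    (x y : PathAlgebra k V) :
    pathAlgebraDerivation δ (x * y) =
      envLeft k (proj I x) * pathAlgebraDerivation δ y +
        envRight k (proj I y) * pathAlgebraDerivation δ x := by
  refine bilinear_ext k (f := fun x y => pathAlgebraDerivation δ (x * y))
    (g := fun x y => envLeft k (proj I x) * pathAlgebraDerivation δ y +
        envRight k (proj I y) * pathAlgebraDerivation δ x)
    ?_ ?_ ?_ ?_ ?_ ?_ ?_ ?_ ?_ x y
  · intro x y z; rw [add_mul, map_add]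
  · intro x y z; rw [mul_add, map_add]
  · intro c x y; rw [smul_mul_assoc, map_smul]
  · intro c x y; rw [mul_smul_comm, map_smul]
  · intro x y z; simp only [map_add, envLeft_add, add_mul, mul_add]; abel
  · intro x y z; simp only [map_add, envRight_add, add_mul, mul_add]; abel
  · intro c x y
    simp only [map_smul, envLeft_smul, smul_mul_assoc, mul_smul_comm, smul_add]
  · intro c x y
    simp only [map_smul, envRight_smul, smul_mul_assoc, mul_smul_comm, smul_add]
  rintro ⟨p₁, p₂, p⟩ ⟨q₁, q₂, q⟩
  rw [ofPath_mul_ofPath]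
  by_cases h : q₂ = p₁
  · subst h
    rw [pathMul_mk, pathAlgebraDerivation_ofPath, pathAlgebraDerivation_ofPath,
      pathAlgebraDerivation_ofPath, pathDerivation_comp hl]
  · rw [pathMul_ne _ _ _ h, map_zero, pathAlgebraDerivation_ofPath, pathAlgebraDerivation_ofPath]
    dsimp only
    have h₀ : vertexElt I p₁ * proj I (ofPath k ⟨q₁, q₂, q⟩) = 0 := by
      rw [vertexElt, ← map_mul, ofPath_mul_ofPath, pathMul_ne _ _ _ h, map_zero]
    have h₁ : proj I (ofPath k ⟨p₁, p₂, p⟩) * vertexElt I q₂ = 0 := by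
      rw [vertexElt, ← map_mul, ofPath_mul_ofPath, pathMul_ne _ _ _ h, map_zero]
    -- The product of the paths is zero, and so is each Leibniz term: inserting the idempotents at
    -- the head of q and the tail of p exposes a zero product.
    rw [← envLeft_mul_pathDerivation hl q, ← envRight_mul_pathDerivation p, ← mul_assoc,
      ← mul_assoc, ← envLeft_mul, ← envRight_mul, h₀, h₁, envLeft_zero, envRight_zero, zero_mul,
      zero_mul, add_zero]

/-- Values on the arrows which are compatible with the relations extend to a derivation. -/
theorem exists_derivation {M : Set (QPath V)} (hM : ∀ p ∈ M, p.2.2.length = 2)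
    (hIM : I = pathIdeal k M)
    (hl : ∀ {i j : V} (a : i ⟶ j), envLeft k (vertexElt I j) * δ a = δ a)
    (hr : ∀ {i j : V} (a : i ⟶ j), envRight k (vertexElt I i) * δ a = δ a)
    (hrel : ∀ {i j l : V} (a : i ⟶ j) (b : j ⟶ l), arrowPath₂ a b ∈ M →
      envLeft k (arrowElt I b) * δ a + envRight k (arrowElt I a) * δ b = 0) :
    ∃ D : BoundQuiverAlgebra I →ₗ[k] Env k (BoundQuiverAlgebra I), IsDerivation k D ∧
      ∀ {i j : V} (a : i ⟶ j), D (arrowElt I a) = δ a := by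
  have arrow : ∀ {i j : V} (a : i ⟶ j), pathDerivation δ a.toPath = δ a := by
    intro i j a
    rw [Quiver.Hom.toPath, pathDerivation, pathDerivation, mul_zero, zero_add]
    exact hr a
  have vanish : ∀ x ∈ I, pathAlgebraDerivation δ x = 0 := by
    intro x hx
    -- Membership in I is part of the condition: of the two Leibniz terms, one vanishes by the value
    -- of the derivation and the other because the element is zero in the quotient.
    let K : TwoSidedIdeal (PathAlgebra k V) := TwoSidedIdeal.mk'
      {x | x ∈ I ∧ pathAlgebraDerivation δ x = 0}
      ⟨I.zero_mem, map_zero _⟩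
      (fun {x y} hx hy => ⟨I.add_mem hx.1 hy.1, by rw [map_add, hx.2, hy.2, add_zero]⟩)
      (fun {x} hx => ⟨I.neg_mem hx.1, by rw [map_neg, hx.2, neg_zero]⟩)
      (fun {x y} hy => ⟨I.mul_mem_left _ _ hy.1, by
        rw [pathAlgebraDerivation_mul hl, hy.2, (proj_eq_zero_iff I).2 hy.1, mul_zero,
          envRight_zero, zero_mul, add_zero]⟩)
      (fun {x y} hx => ⟨I.mul_mem_right _ _ hx.1, by
        rw [pathAlgebraDerivation_mul hl, hx.2, (proj_eq_zero_iff I).2 hx.1, mul_zero,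
          envLeft_zero, zero_mul, add_zero]⟩)
    have hK : I ≤ K := by
      conv_lhs => rw [hIM]
      refine TwoSidedIdeal.span_le.2 ?_
      rintro _ ⟨p, hp, rfl⟩
      refine (TwoSidedIdeal.mem_mk' _ _ _ _ _ _ _).2 ⟨?_, ?_⟩
      · rw [hIM]; exact TwoSidedIdeal.subset_span ⟨p, hp, rfl⟩
      · have hlen := hM p hp
        obtain ⟨i, l, p⟩ := p
        rw [pathAlgebraDerivation_ofPath]
        cases p with
        | nil => simp at hlen
        | cons p b =>
          cases p with
          | nil => simp at hlen
          | cons p a =>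
            cases p with
            | cons p c => simp at hlen
            | nil =>
              change pathDerivation δ ((Quiver.Hom.toPath a).cons b) = 0
              rw [pathDerivation, arrow]
              exact hrel a b hp
    have h := hK hx
    rw [TwoSidedIdeal.mem_mk'] at h
    exact h.2
  refine ⟨descend I (pathAlgebraDerivation δ) vanish, fun x y => ?_, fun a => ?_⟩
  · obtain ⟨x, rfl⟩ := proj_surjective I x
    obtain ⟨y, rfl⟩ := proj_surjective I y
    rw [← map_mul, descend_proj, descend_proj, descend_proj, pathAlgebraDerivation_mul hl]
  · rw [arrowElt, descend_proj, pathAlgebraDerivation_ofPath]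
    exact arrow a

end Construction

/-! ### Inner derivations force leaves -/

section LeafArrows

variable {V : Type} [Quiver.{0} V]

/-- The tail of `a` is a source from which only `a` starts. -/
def IsLeafSource {i j : V} (a : i ⟶ j) : Prop :=
  (∀ (l : V) (b : i ⟶ l), (⟨l, b⟩ : Σ l : V, (i ⟶ l)) = ⟨j, a⟩) ∧ ∀ l : V, IsEmpty (l ⟶ i)

/-- The head of `a` is a sink in which only `a` ends. -/
def IsLeafSink {i j : V} (a : i ⟶ j) : Prop :=
  (∀ (l : V) (b : l ⟶ j), (⟨l, b⟩ : Σ l : V, (l ⟶ j)) = ⟨i, a⟩) ∧ ∀ l : V, IsEmpty (j ⟶ l)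

variable {k : Type u} [Field k] [Fintype V] {I : TwoSidedIdeal (PathAlgebra k V)}
  {M : Set (QPath V)} (hM : ∀ p ∈ M, p.2.2.length = 2) (hIM : I = pathIdeal k M)

-- Take n on a and zero on all other arrows. The two terms of each relation then vanish separately,
-- also when a is a loop occurring in both places.
include hM hIM in
theorem exists_derivation_of_arrow {i j : V} (a : i ⟶ j) (n : Env k (BoundQuiverAlgebra I))
    (hl : envLeft k (vertexElt I j) * n = n) (hr : envRight k (vertexElt I i) * n = n)
    (hout : ∀ (l : V) (b : j ⟶ l), arrowPath₂ a b ∈ M → envLeft k (arrowElt I b) * n = 0)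
    (hin : ∀ (l : V) (c : l ⟶ i), arrowPath₂ c a ∈ M → envRight k (arrowElt I c) * n = 0) :
    ∃ D : BoundQuiverAlgebra I →ₗ[k] Env k (BoundQuiverAlgebra I), IsDerivation k D ∧
      D (arrowElt I a) = n ∧ ∀ (i' j' : V) (b : i' ⟶ j'),
        (⟨i', j', b⟩ : Σ i j : V, (i ⟶ j)) ≠ ⟨i, j, a⟩ → D (arrowElt I b) = 0 := by
  classical
  obtain ⟨D, hD, hDa⟩ := exists_derivation (I := I)
    (δ := fun {i' j'} b => if (⟨i', j', b⟩ : Σ i j : V, (i ⟶ j)) = ⟨i, j, a⟩ then n else 0)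
    hM hIM
    (fun b => by
      split_ifs with h
      · cases h; exact hl
      · rw [mul_zero])
    (fun b => by
      split_ifs with h
      · cases h; exact hr
      · rw [mul_zero])
    (fun {i₁ j₁ l₁} c b hcb => by
      have e₁ : envLeft k (arrowElt I b) *
          (if (⟨i₁, j₁, c⟩ : Σ i j : V, (i ⟶ j)) = ⟨i, j, a⟩ then n else 0) = 0 := by
        split_ifs with h
        · cases h; exact hout _ _ hcb
        · rw [mul_zero]
      have e₂ : envRight k (arrowElt I c) *
          (if (⟨j₁, l₁, b⟩ : Σ i j : V, (i ⟶ j)) = ⟨i, j, a⟩ then n else 0) = 0 := by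
        split_ifs with h
        · cases h; exact hin _ _ hcb
        · rw [mul_zero]
      rw [e₁, e₂, add_zero])
  refine ⟨D, hD, ?_, fun i' j' b hb => ?_⟩
  · rw [hDa, if_pos rfl]
  · rw [hDa, if_neg hb]

variable (hI : I ≤ pathIdeal k {p : QPath V | p.2.2.length = 2})

/-- The coefficient of a trivial path, as an element of the dual bimodule. -/
def vertexDual (i : V) : DualBimodule k (BoundQuiverAlgebra I) := vertexCoeff hI i

/-- The coefficient of an arrow, as an element of the dual bimodule. -/
def arrowDual {i j : V} (a : i ⟶ j) : DualBimodule k (BoundQuiverAlgebra I) := arrowCoeff hI a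

theorem arrowElt_smul_vertexDual (l : V) {i j : V} (a : i ⟶ j) :
    arrowElt I a • vertexDual hI l = 0 :=
  LinearMap.ext fun x => by
    change vertexCoeff hI l (x * arrowElt I a) = 0
    rw [vertexCoeff_mul, vertexCoeff_arrowElt, mul_zero]

theorem arrowElt_smul_arrowDual {i j : V} (a : i ⟶ j) :
    arrowElt I a • arrowDual hI a = vertexDual hI j :=
  LinearMap.ext fun x => by
    change arrowCoeff hI a (x * arrowElt I a) = vertexCoeff hI j x
    rw [arrowCoeff_mul, vertexCoeff_arrowElt, arrowCoeff_arrowElt_self, mul_zero, zero_add, mul_one]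

variable (hinn : DerivationsInner k (BoundQuiverAlgebra I))

include hM hIM hI hinn

/-- An arrow which occurs in no relation gives an outer derivation. -/
theorem exists_relation {i j : V} (a : i ⟶ j) :
    (∃ (l : V) (b : j ⟶ l), arrowPath₂ a b ∈ M) ∨ ∃ (l : V) (c : l ⟶ i), arrowPath₂ c a ∈ M := by
  by_contra! hno
  obtain ⟨D, hD, hDa, -⟩ := exists_derivation_of_arrow hM hIM a
    (vertexElt I j ⊗ₜ[k] MulOpposite.op (vertexElt I i))
    (by rw [envLeft, Algebra.TensorProduct.tmul_mul_tmul, one_mul, vertexElt_mul_self])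
    (by rw [envRight, Algebra.TensorProduct.tmul_mul_tmul, one_mul, ← MulOpposite.op_mul,
      vertexElt_mul_self])
    (fun l b h => absurd h (hno.1 l b)) (fun l c h => absurd h (hno.2 l c))
  obtain ⟨h, hh⟩ := hinn D hD
  -- The functional of e_i is killed by a. So the contraction, which is e_j, would equal a ·
  -- h(e_i^*), an element without e_j-term.
  have e := congrArg (vertexCoeff hI j) (hh (arrowElt I a) (vertexDual hI i))
  rw [hDa, arrowElt_smul_vertexDual, map_zero, sub_zero, vertexCoeff_mul, vertexCoeff_arrowElt,
    zero_mul, contract_tmul, map_smul, vertexCoeff_vertexElt_self] at e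
  change vertexCoeff hI i (vertexElt I i) • (1 : k) = 0 at e
  rw [vertexCoeff_vertexElt_self, one_smul] at e
  exact one_ne_zero e

/-- Use a ↦ a ⊗ e_i. If it is inner via h, let t be the e_i-coefficient of h(e_i^*). For each arrow
b out of i, t is the b-coefficient of the contraction of D(b) with e_i^*: this is 1 for b = a and 0
for b ≠ a. For each arrow c into i, contraction of D(c) with c^* has e_i-coefficient −t, since c ·
c^* = e_i^*; but that coefficient is 0. -/
theorem isLeafSource_of_relation {i j : V} (a : i ⟶ j)
    (hin : ∀ (l : V) (c : l ⟶ i), arrowPath₂ c a ∉ M) : IsLeafSource a := by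
  obtain ⟨D, hD, hDa, hDb⟩ := exists_derivation_of_arrow hM hIM a
    (arrowElt I a ⊗ₜ[k] MulOpposite.op (vertexElt I i))
    (by rw [envLeft, Algebra.TensorProduct.tmul_mul_tmul, one_mul, vertexElt_mul_arrowElt])
    (by rw [envRight, Algebra.TensorProduct.tmul_mul_tmul, one_mul, ← MulOpposite.op_mul,
      vertexElt_mul_self])
    (fun l b h => by
      rw [envLeft, Algebra.TensorProduct.tmul_mul_tmul, arrowElt_mul_arrowElt,
        (proj_eq_zero_iff I).2, TensorProduct.zero_tmul]
      rw [hIM]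
      exact TwoSidedIdeal.subset_span ⟨_, h, rfl⟩)
    (fun l c h => absurd h (hin l c))
  obtain ⟨h, hh⟩ := hinn D hD
  have out : ∀ (l : V) (b : i ⟶ l), arrowCoeff hI b (contract (vertexDual hI i)
      (D (arrowElt I b))) = vertexCoeff hI i (h (vertexDual hI i)) := by
    intro l b
    rw [hh, arrowElt_smul_vertexDual, map_zero, sub_zero, arrowCoeff_mul,
      arrowCoeff_arrowElt_self, vertexCoeff_arrowElt, zero_mul, add_zero, one_mul]
  have e₁ : vertexCoeff hI i (h (vertexDual hI i)) = 1 := by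
    rw [← out j a, hDa, contract_tmul, map_smul, arrowCoeff_arrowElt_self]
    change vertexCoeff hI i (vertexElt I i) • (1 : k) = 1
    rw [vertexCoeff_vertexElt_self, one_smul]
  refine ⟨fun l b => ?_, fun l => ⟨fun c => ?_⟩⟩
  · by_contra hne
    have e₂ := out l b
    rw [hDb _ _ b (fun e => hne (by cases e; rfl)), map_zero, map_zero, e₁] at e₂
    exact zero_ne_one e₂
  · have e₂ := congrArg (vertexCoeff hI i) (hh (arrowElt I c) (arrowDual hI c))
    rw [arrowElt_smul_arrowDual, map_sub, vertexCoeff_mul, vertexCoeff_arrowElt, zero_mul,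
      zero_sub, e₁] at e₂
    have e₃ : vertexCoeff hI i (contract (arrowDual hI c) (D (arrowElt I c))) = 0 := by
      -- If c = a is a loop, the contraction is a multiple of a, which still has no e_i-term.
      by_cases hc : (⟨l, i, c⟩ : Σ i j : V, (i ⟶ j)) = ⟨i, j, a⟩
      · cases hc
        rw [hDa, contract_tmul, map_smul, vertexCoeff_arrowElt, smul_zero]
      · rw [hDb _ _ c hc, map_zero, map_zero]
    rw [e₃] at e₂
    exact one_ne_zero (neg_eq_zero.1 e₂.symm)

/-- Use b ↦ e_j ⊗ b. The roles are exchanged: arrows into j, tested by their own functionals, all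
yield minus the e_j-coefficient of h(e_j^*), while arrows out of j, tested by e_j^*, force that
coefficient to be 0. -/
theorem isLeafSink_of_relation {i j : V} (b : i ⟶ j)
    (hout : ∀ (l : V) (c : j ⟶ l), arrowPath₂ b c ∉ M) : IsLeafSink b := by
  obtain ⟨D, hD, hDa, hDb⟩ := exists_derivation_of_arrow hM hIM b
    (vertexElt I j ⊗ₜ[k] MulOpposite.op (arrowElt I b))
    (by rw [envLeft, Algebra.TensorProduct.tmul_mul_tmul, one_mul, vertexElt_mul_self])
    (by rw [envRight, Algebra.TensorProduct.tmul_mul_tmul, one_mul, ← MulOpposite.op_mul,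
      arrowElt_mul_vertexElt])
    (fun l c h => absurd h (hout l c))
    (fun l c h => by
      rw [envRight, Algebra.TensorProduct.tmul_mul_tmul, ← MulOpposite.op_mul,
        arrowElt_mul_arrowElt, (proj_eq_zero_iff I).2, MulOpposite.op_zero,
        TensorProduct.tmul_zero]
      rw [hIM]
      exact TwoSidedIdeal.subset_span ⟨_, h, rfl⟩)
  obtain ⟨h, hh⟩ := hinn D hD
  have into : ∀ (l : V) (c : l ⟶ j), vertexCoeff hI j (contract (arrowDual hI c)
      (D (arrowElt I c))) = - vertexCoeff hI j (h (vertexDual hI j)) := by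
    intro l c
    rw [hh, arrowElt_smul_arrowDual, map_sub, vertexCoeff_mul, vertexCoeff_arrowElt, zero_mul,
      zero_sub]
  have e₁ : - vertexCoeff hI j (h (vertexDual hI j)) = 1 := by
    rw [← into i b, hDa, contract_tmul, map_smul, vertexCoeff_vertexElt_self]
    change arrowCoeff hI b (arrowElt I b) • (1 : k) = 1
    rw [arrowCoeff_arrowElt_self, one_smul]
  refine ⟨fun l c => ?_, fun l => ⟨fun c => ?_⟩⟩
  · by_contra hne
    have e₂ := into l c
    rw [hDb _ _ c (fun e => hne (by cases e; rfl)), map_zero, map_zero, e₁] at e₂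
    exact zero_ne_one e₂
  · have e₂ := congrArg (arrowCoeff hI c) (hh (arrowElt I c) (vertexDual hI j))
    rw [arrowElt_smul_vertexDual, map_zero, sub_zero, arrowCoeff_mul, arrowCoeff_arrowElt_self,
      vertexCoeff_arrowElt, zero_mul, add_zero, one_mul] at e₂
    have e₃ : arrowCoeff hI c (contract (vertexDual hI j) (D (arrowElt I c))) = 0 := by
      by_cases hc : (⟨j, l, c⟩ : Σ i j : V, (i ⟶ j)) = ⟨i, j, b⟩
      · cases hc
        rw [hDa, contract_tmul, map_smul, arrowCoeff_vertexElt, smul_zero]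
      · rw [hDb _ _ c hc, map_zero, map_zero]
    rw [← e₂, e₃, neg_zero] at e₁
    exact zero_ne_one e₁

/-- If all derivations are inner and no two relations overlap, then every arrow is a leaf. -/
theorem isLeafSource_or_isLeafSink
    (hchain : ∀ {i j l m : V} (c : i ⟶ j) (a : j ⟶ l) (b : l ⟶ m),
      arrowPath₂ c a ∈ M → arrowPath₂ a b ∉ M) {i j : V} (a : i ⟶ j) :
    IsLeafSource a ∨ IsLeafSink a := by
  obtain ⟨l, b, hb⟩ | ⟨l, c, hc⟩ := exists_relation hM hIM hI hinn a
  · exact Or.inl (isLeafSource_of_relation hM hIM hI hinn a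
      fun l c hc => hchain c a b hc hb)
  · exact Or.inr (isLeafSink_of_relation hM hIM hI hinn a fun l b => hchain c a b hc)

end LeafArrows

/-! ### Consequences of the global dimension -/

section GlobalDimension

theorem hasProjectiveDimensionLE_of_globalDimension_le {R : Type u} [Ring R] {n : ℕ}
    (h : globalDimension R ≤ n) (M : ModuleCat.{u} R) : HasProjectiveDimensionLE M n :=
  (projectiveDimension_le_iff M n).1 ((le_iSup (fun M : ModuleCat.{u} R => projectiveDimension M)
    M).trans h)

/-- If the global dimension is at most two, then left annihilators of elements are projective. -/
theorem projective_ker_mulRight {R : Type u} [Ring R] (h : globalDimension R ≤ (2 : ℕ)) (c : R) :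
    Module.Projective R (LinearMap.ker (LinearMap.toSpanSingleton R R c)) := by
  -- The annihilator is the second syzygy of R/Rc, via R → R/Rc with kernel Rc and R → Rc; each step
  -- lowers the bound on the projective dimension by one.
  let S : Submodule R R := LinearMap.range (LinearMap.toSpanSingleton R R c)
  have h₁ := LinearMap.shortExact_shortComplexKer (f := S.mkQ) S.mkQ_surjective
  have p₁ : HasProjectiveDimensionLT (ModuleCat.of R (LinearMap.ker S.mkQ)) 2 :=
    h₁.hasProjectiveDimensionLT_X₁ 2
      (inferInstanceAs (HasProjectiveDimensionLT (ModuleCat.of R R) 2))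
      (hasProjectiveDimensionLE_of_globalDimension_le h _)
  let g : R →ₗ[R] LinearMap.ker S.mkQ :=
    (LinearMap.toSpanSingleton R R c).codRestrict (LinearMap.ker S.mkQ) fun x => by
      rw [Submodule.ker_mkQ]
      exact ⟨x, rfl⟩
  have hg : Function.Surjective g := by
    rintro ⟨y, hy⟩
    rw [Submodule.ker_mkQ] at hy
    obtain ⟨x, rfl⟩ := hy
    exact ⟨x, rfl⟩
  have h₂ := LinearMap.shortExact_shortComplexKer (f := g) hg
  have p₂ : HasProjectiveDimensionLT (ModuleCat.of R (LinearMap.ker g)) 1 :=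
    h₂.hasProjectiveDimensionLT_X₁ 1
      (inferInstanceAs (HasProjectiveDimensionLT (ModuleCat.of R R) 1)) p₁
  have p₃ : Module.Projective R (LinearMap.ker g) :=
    (IsProjective.iff_projective _).2 (projective_iff_hasProjectiveDimensionLT_one.2 p₂)
  have e : LinearMap.ker g = LinearMap.ker (LinearMap.toSpanSingleton R R c) :=
    LinearMap.ker_codRestrict _ _ _
  rwa [e] at p₃

/-- A connected quiver without arrows is a point. -/
theorem subsingleton_of_isEmpty_hom {V : Type} [Quiver.{0} V]
    (hconn : Subsingleton (Quiver.WeaklyConnectedComponent V))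
    (h : ∀ i j : V, IsEmpty (i ⟶ j)) : Subsingleton V := by
  refine ⟨fun i j => ?_⟩
  obtain ⟨p⟩ := (Quiver.WeaklyConnectedComponent.eq i j).1 (Subsingleton.elim _ _)
  induction p with
  | nil => rfl
  | cons p e ih =>
    rcases e with e | e
    · exact ((h _ _).false e).elim
    · exact ((h _ _).false e).elim

variable {k : Type u} [Field k] {V : Type} [Quiver.{0} V] [Fintype V]
  {I : TwoSidedIdeal (PathAlgebra k V)}

/-- If the global dimension is at most two, then relations do not overlap. -/
theorem mul_ne_zero_of_mul_eq_zero (hI : I ≤ pathIdeal k {p : QPath V | p.2.2.length = 2})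
    (h : globalDimension (BoundQuiverAlgebra I) ≤ (2 : ℕ)) {i j l m : V}
    (c : i ⟶ j) (a : j ⟶ l) (b : l ⟶ m) (hac : arrowElt I a * arrowElt I c = 0) :
    arrowElt I b * arrowElt I a ≠ 0 := by
  intro hba
  let P := LinearMap.ker (LinearMap.toSpanSingleton (BoundQuiverAlgebra I)
    (BoundQuiverAlgebra I) (arrowElt I c))
  have hP : Module.Projective (BoundQuiverAlgebra I) P := projective_ker_mulRight h (arrowElt I c)
  -- A section of the canonical cover writes a as a sum of terms s_x(a) x with xc = 0, and linearity
  -- gives b s_x(a) = s_x(ba) = 0. The first makes the e_j-coefficient of x vanish, the second the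
  -- e_l-coefficient of s_x(a), so no term contains a.
  obtain ⟨s, hs⟩ := Module.projective_def.1 hP
  let a' : P := ⟨arrowElt I a, hac⟩
  have hsa := congrArg Subtype.val (hs a')
  rw [Finsupp.linearCombination_apply, Finsupp.sum, AddSubmonoidClass.coe_finsetSum] at hsa
  have hsum := congrArg (arrowCoeff hI a) hsa
  rw [map_sum, Finset.sum_eq_zero] at hsum
  · change 0 = arrowCoeff hI a (arrowElt I a) at hsum
    rw [arrowCoeff_arrowElt_self] at hsum
    exact zero_ne_one hsum
  · intro x _
    change arrowCoeff hI a (s a' x * (x : BoundQuiverAlgebra I)) = 0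
    have h₁ : vertexCoeff hI j (x : BoundQuiverAlgebra I) = 0 := by
      have hx : (x : BoundQuiverAlgebra I) * arrowElt I c = 0 := x.2
      have e := congrArg (arrowCoeff hI c) hx
      rwa [arrowCoeff_mul, vertexCoeff_arrowElt, mul_zero, zero_add, arrowCoeff_arrowElt_self,
        mul_one, map_zero] at e
    have h₂ : vertexCoeff hI l (s a' x) = 0 := by
      have hb : arrowElt I b • a' = 0 := Subtype.ext hba
      have hx : arrowElt I b * s a' x = 0 := by
        rw [← smul_eq_mul, ← Finsupp.smul_apply, ← map_smul, hb, map_zero, Finsupp.zero_apply]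
      have e := congrArg (arrowCoeff hI b) hx
      rwa [arrowCoeff_mul, vertexCoeff_arrowElt, zero_mul, add_zero, arrowCoeff_arrowElt_self,
        one_mul, map_zero] at e
    rw [arrowCoeff_mul, h₁, h₂, mul_zero, zero_mul, add_zero]

/-- The algebra of a quiver with one vertex and no arrows has global dimension zero. -/
theorem globalDimension_le_zero [Nonempty V]
    (hconn : Subsingleton (Quiver.WeaklyConnectedComponent V))
    (h : ∀ i j : V, IsEmpty (i ⟶ j)) : globalDimension (BoundQuiverAlgebra I) ≤ (0 : ℕ) := by
  have hV := subsingleton_of_isEmpty_hom hconn h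
  have hsurj : Function.Surjective (algebraMap k (BoundQuiverAlgebra I)) := by
    -- The only path is the trivial one, so the algebra is a quotient of k and hence semisimple.
    have hone : ∀ p : QPath V, ofPath k p = 1 := by
      rintro ⟨i, j, p⟩
      cases p with
      | cons p a => exact ((h _ _).false a).elim
      | nil =>
        rw [one_def, Finset.sum_eq_single i (fun l _ hl => absurd (Subsingleton.elim l i) hl)]
        simp
    have hP : ∀ x : PathAlgebra k V, ∃ c : k, algebraMap k _ c = x := by
      intro x
      induction x using PathAlgebra.induction_on with
      | h0 => exact ⟨0, map_zero _⟩
      | hadd a b ha hb =>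
        obtain ⟨c, rfl⟩ := ha
        obtain ⟨d, rfl⟩ := hb
        exact ⟨c + d, map_add _ _ _⟩
      | hs c p => exact ⟨c, by rw [hone, Algebra.algebraMap_eq_smul_one]⟩
    intro y
    obtain ⟨x, rfl⟩ := proj_surjective I y
    obtain ⟨c, rfl⟩ := hP x
    exact ⟨c, ((proj I).commutes c).symm⟩
  have hss : IsSemisimpleRing (BoundQuiverAlgebra I) :=
    RingHom.isSemisimpleRing_of_surjective (algebraMap k (BoundQuiverAlgebra I)) hsurj
  refine iSup_le fun M => (projectiveDimension_le_iff M 0).2 ?_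
  have hM : Projective M :=
    (IsProjective.iff_projective M).1 (Module.projective_of_isSemisimpleRing _ _)
  exact (projective_iff_hasProjectiveDimensionLE_zero M).1 hM

end GlobalDimension

/-! ### From vanishing Ext¹ over Λ^e to inner derivations -/

section Outer

variable {k : Type u} [Field k] {Λ : Type u} [Ring Λ] [Algebra k Λ]

variable (k Λ) in
/-- The multiplication map `Λ^e → Λ`. -/
def envMul : Env k Λ →ₗ[k] Λ :=
  (LinearMap.mul' k Λ).comp
    (TensorProduct.map LinearMap.id (MulOpposite.opLinearEquiv k).symm.toLinearMap)

theorem envMul_tmul (a : Λ) (b : Λᵐᵒᵖ) : envMul k Λ (a ⊗ₜ[k] b) = a * b.unop := rfl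

variable (k Λ) in
/-- The multiplication map `Λ^e → Λ`, as a map of left `Λ^e`-modules. -/
def envAugmentation : Env k Λ →ₗ[Env k Λ] regularBimodule k Λ :=
  LinearMap.toSpanSingleton (Env k Λ) (regularBimodule k Λ) (1 : Λ)

theorem envAugmentation_apply (n : Env k Λ) : envAugmentation k Λ n = envMul k Λ n := by
  induction n using TensorProduct.induction_on with
  | zero => rw [map_zero, map_zero]; rfl
  | add a b ha hb => rw [map_add, map_add, ha, hb]; rfl
  | tmul a b =>
    let : Module (Env k Λ) Λ := TensorProduct.Algebra.module
    refine (TensorProduct.Algebra.smul_def a b (1 : Λ)).trans ?_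
    change a * (1 * b.unop) = a * b.unop
    rw [one_mul]

theorem envAugmentation_surjective : Function.Surjective (envAugmentation k Λ) := fun x =>
  ⟨envLeft k (show Λ from x), (envAugmentation_apply _).trans (mul_one (show Λ from x))⟩

/-- The map `a ⊗ b ↦ D(a) b`. -/
def derivationLift (D : Λ →ₗ[k] Env k Λ) : Env k Λ →ₗ[k] Env k Λ :=
  TensorProduct.lift (LinearMap.mk₂ k (fun (a : Λ) (b : Λᵐᵒᵖ) => envRight k b.unop * D a)
    (fun a a' b => by rw [map_add, mul_add])
    (fun c a b => by rw [map_smul, mul_smul_comm])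
    (fun a b b' => by rw [MulOpposite.unop_add, envRight_add, add_mul])
    (fun c a b => by rw [MulOpposite.unop_smul, envRight_smul, smul_mul_assoc]))

theorem derivationLift_tmul (D : Λ →ₗ[k] Env k Λ) (a : Λ) (b : Λᵐᵒᵖ) :
    derivationLift D (a ⊗ₜ b) = envRight k b.unop * D a := rfl

/-- The Leibniz rule leaves the error term D(a) · μ(n) · b, with μ the multiplication map. The lift
is therefore Λ^e-linear on the kernel of μ, though not on all of Λ^e. -/
theorem derivationLift_tmul_mul {D : Λ →ₗ[k] Env k Λ} (hD : IsDerivation k D) (a : Λ) (b : Λᵐᵒᵖ)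
    (n : Env k Λ) : derivationLift D ((a ⊗ₜ b) * n) =
      (a ⊗ₜ b) * derivationLift D n + envRight k b.unop * envRight k (envMul k Λ n) * D a := by
  induction n using TensorProduct.induction_on with
  | zero => simp [envRight_zero]
  | add x y hx hy =>
    rw [mul_add, map_add, hx, hy, map_add, map_add, envRight_add, mul_add, mul_add, add_mul]
    abel
  | tmul u v =>
    have hab : (a ⊗ₜ[k] b : Env k Λ) = envRight k b.unop * envLeft k a := by
      simp [envLeft, envRight]
    rw [Algebra.TensorProduct.tmul_mul_tmul, derivationLift_tmul, derivationLift_tmul, hD,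
      envMul_tmul, hab, MulOpposite.unop_mul, envRight_mul, envRight_mul, mul_add]
    congr 1
    · rw [mul_assoc, mul_assoc, ← mul_assoc (envRight k v.unop), ← envLeft_mul_envRight, mul_assoc]
    · simp only [mul_assoc]

theorem derivationLift_mul_of_envMul_eq_zero {D : Λ →ₗ[k] Env k Λ} (hD : IsDerivation k D)
    (c : Env k Λ) {n : Env k Λ} (hn : envMul k Λ n = 0) :
    derivationLift D (c * n) = c * derivationLift D n := by
  induction c using TensorProduct.induction_on with
  | zero => simp
  | add x y hx hy => rw [add_mul, map_add, hx, hy, add_mul]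
  | tmul a b =>
    rw [derivationLift_tmul_mul hD, hn, envRight_zero, mul_zero, zero_mul, add_zero]

/-- The long exact sequence for 0 → ker μ → Λ^e → Λ → 0 extends the map defined by D to all of Λ^e,
where it is right multiplication by the image n₀ of 1. -/
theorem derivationsInner_of_subsingleton_ext (h : Subsingleton (ExtEnv k Λ 1)) :
    DerivationsInner k Λ := by
  intro D hD
  let φ : LinearMap.ker (envAugmentation k Λ) →ₗ[Env k Λ] Env k Λ :=
    { toFun := fun n => derivationLift D n
      map_add' := fun m n => map_add _ _ _
      map_smul' := fun c n => derivationLift_mul_of_envMul_eq_zero hD c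
        ((envAugmentation_apply _).symm.trans n.2) }
  have hS := LinearMap.shortExact_shortComplexKer (f := envAugmentation k Λ)
    envAugmentation_surjective
  obtain ⟨x, hx⟩ := Abelian.Ext.contravariant_sequence_exact₁ hS
    (ModuleCat.of (Env k Λ) (Env k Λ))
    (Abelian.Ext.mk₀ (ModuleCat.ofHom φ)) (n₁ := 1) rfl (h.elim _ _)
  obtain ⟨ψ, rfl⟩ := (Abelian.Ext.mk₀_bijective _ _).2 x
  rw [Abelian.Ext.mk₀_comp_mk₀] at hx
  have hψ := (Abelian.Ext.mk₀_bijective _ _).1 hx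
  have key : ∀ n : LinearMap.ker (envAugmentation k Λ),
      ψ.hom (n : Env k Λ) = derivationLift D n :=
    fun n => congrArg (fun f => f.hom n) hψ
  let n₀ : Env k Λ := ψ.hom (1 : Env k Λ)
  have inner : ∀ x : Λ, D x = envLeft k x * n₀ - envRight k x * n₀ := by
    intro x
    -- The lift sends x ⊗ 1 − 1 ⊗ x to D(x), as D(1) = 0; the extended map sends it to the
    -- commutator of x with n₀.
    have hker : envAugmentation k Λ (envLeft k x - envRight k x) = 0 := by
      rw [envAugmentation_apply, map_sub, envLeft, envRight, envMul_tmul, envMul_tmul]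
      exact (congrArg₂ (· - ·) (mul_one x) (one_mul x)).trans (sub_self x)
    have h₁ := key ⟨_, hker⟩
    have h₂ : ψ.hom (envLeft k x - envRight k x) = (envLeft k x - envRight k x) * n₀ := by
      have h₃ := ψ.hom.map_smul (envLeft k x - envRight k x) (1 : Env k Λ)
      rw [smul_eq_mul, mul_one] at h₃
      exact h₃
    rw [← sub_mul, ← h₂]
    refine Eq.trans ?_ h₁.symm
    rw [map_sub, envLeft, envRight, derivationLift_tmul, derivationLift_tmul, hD.map_one, mul_zero,
      sub_zero, MulOpposite.unop_one, envRight_one, one_mul]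
  refine ⟨{ toFun := fun φ => contract φ n₀, map_zero' := contract_zero n₀,
            map_add' := fun φ ψ => contract_add φ ψ n₀ }, fun x φ => ?_⟩
  rw [inner, map_sub, contract_envLeft_mul, contract_envRight_mul]
  rfl

end Outer

/-! ### Derivations as extensions of DΛ by Λ -/

section TwistedExtension

variable {k : Type u} [Field k] {Λ : Type u} [Ring Λ] [Algebra k Λ]

/-- The extension of `DΛ` by `Λ` defined by a derivation. -/
def TwistedExtension (D : Λ →ₗ[k] Env k Λ) (_ : IsDerivation k D) : Type u :=
  Λ × DualBimodule k Λ

variable {D : Λ →ₗ[k] Env k Λ} {hD : IsDerivation k D}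

instance : AddCommGroup (TwistedExtension D hD) :=
  inferInstanceAs (AddCommGroup (Λ × DualBimodule k Λ))

/-- Associativity of the twisted action is the Leibniz rule, and unitality is D(1) = 0. -/
instance : Module Λ (TwistedExtension D hD) where
  smul a x := (a * x.1 + contract x.2 (D a), a • x.2)
  one_smul x := Prod.ext
    (show 1 * x.1 + contract x.2 (D 1) = x.1 by rw [hD.map_one, map_zero, one_mul, add_zero])
    (one_smul Λ x.2)
  mul_smul a b x := Prod.ext
    (show a * b * x.1 + contract x.2 (D (a * b)) =
        a * (b * x.1 + contract x.2 (D b)) + contract (b • x.2) (D a) by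
      rw [hD, map_add, contract_envLeft_mul, contract_envRight_mul, mul_add, mul_assoc, add_assoc])
    (mul_smul a b x.2)
  smul_zero a := Prod.ext
    (show a * 0 + contract (0 : DualBimodule k Λ) (D a) = 0 by
      rw [contract_zero, mul_zero, add_zero])
    (smul_zero a)
  smul_add a x y := Prod.ext
    (show a * (x.1 + y.1) + contract (x.2 + y.2) (D a) =
        a * x.1 + contract x.2 (D a) + (a * y.1 + contract y.2 (D a)) by
      rw [contract_add, mul_add]; abel)
    (smul_add a x.2 y.2)
  add_smul a b x := Prod.ext
    (show (a + b) * x.1 + contract x.2 (D (a + b)) =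
        a * x.1 + contract x.2 (D a) + (b * x.1 + contract x.2 (D b)) by
      rw [map_add, map_add, add_mul]; abel)
    (add_smul a b x.2)
  zero_smul x := Prod.ext
    (show 0 * x.1 + contract x.2 (D 0) = 0 by rw [map_zero, map_zero, zero_mul, add_zero])
    (zero_smul Λ x.2)

variable (D hD) in
/-- The inclusion of `Λ` into the extension. -/
def TwistedExtension.incl : Λ →ₗ[Λ] TwistedExtension D hD where
  toFun l := (l, 0)
  map_add' l m := Prod.ext rfl (add_zero (0 : DualBimodule k Λ)).symm
  map_smul' a l := Prod.ext
    (show a * l = a * l + contract (0 : DualBimodule k Λ) (D a) by rw [contract_zero, add_zero])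
    (smul_zero a).symm

variable (D hD) in
/-- The projection of the extension onto `DΛ`. -/
def TwistedExtension.proj : TwistedExtension D hD →ₗ[Λ] DualBimodule k Λ where
  toFun x := x.2
  map_add' _ _ := rfl
  map_smul' _ _ := rfl

variable (k Λ) in
/-- If every extension of `DΛ` by `Λ` splits, then all derivations are inner. -/
theorem derivationsInner_of_retractions
    (h : ∀ (E : ModuleCat.{u} Λ) (ι : ModuleCat.of Λ Λ ⟶ E)
      (π : E ⟶ ModuleCat.of Λ (DualBimodule k Λ)), Function.Injective ι.hom →
      Function.Surjective π.hom → Function.Exact ι.hom π.hom →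
      ∃ r : E ⟶ ModuleCat.of Λ Λ, ι ≫ r = 𝟙 _) : DerivationsInner k Λ := by
  intro D hD
  obtain ⟨r, hr⟩ := h (ModuleCat.of Λ (TwistedExtension D hD))
    (ModuleCat.ofHom (TwistedExtension.incl D hD)) (ModuleCat.ofHom (TwistedExtension.proj D hD))
    (fun x y hxy => congrArg Prod.fst hxy) (fun φ => ⟨((0 : Λ), φ), rfl⟩)
    (fun x => ⟨fun hx => ⟨x.1, Prod.ext rfl hx.symm⟩, fun ⟨l, hl⟩ => by rw [← hl]; rfl⟩)
  let ρ : TwistedExtension D hD →ₗ[Λ] Λ := r.hom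
  have hρ : ∀ l : Λ, ρ (l, (0 : DualBimodule k Λ)) = l := fun l => congrArg (fun f => f.hom l) hr
  have hadd : ∀ (l l' : Λ) (φ φ' : DualBimodule k Λ),
      ρ (l + l', φ + φ') = ρ (l, φ) + ρ (l', φ') := fun l l' φ φ' => ρ.map_add (l, φ) (l', φ')
  -- The additive map h is the retraction on the second summand; its linearity at x · (0, φ) is the
  -- formula for an inner derivation.
  refine ⟨{ toFun := fun φ => ρ ((0 : Λ), φ), map_zero' := hρ 0, map_add' := fun φ ψ => ?_ },
    fun x φ => ?_⟩
  · rw [← hadd, add_zero]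
  · have h₁ : ρ (x * 0 + contract φ (D x), x • φ) = x * ρ ((0 : Λ), φ) :=
      ρ.map_smul x ((0 : Λ), φ)
    have h₂ := hadd (contract φ (D x)) 0 0 (x • φ)
    rw [add_zero, zero_add, hρ] at h₂
    rw [mul_zero, zero_add, h₂] at h₁
    exact eq_sub_of_add_eq h₁

end TwistedExtension

/-! ### From 2-hereditary to inner derivations -/

section Complexes

variable {k : Type u} [Field k] {Λ : Type u} [Ring Λ] [Algebra k Λ]

/-- Lift Λ ≅ H⁰(J) to cycles, as Λ is projective, and extend to t : E → J⁰, as J⁰ is injective. Then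
dt kills Λ and so comes from a 1-cocycle of Hom(B, J), which is the coboundary of some g. The
correction t − gπ lands in the cycles, and passing to H⁰(J) gives the retraction. -/
theorem exists_retraction {B : Type u} [AddCommGroup B] [Module Λ B] [Module Λᵐᵒᵖ B]
    [SMulCommClass Λ Λᵐᵒᵖ B] (J : CochainComplex (ModuleCat.{u} Λ) ℤ)
    (hJ : Injective (J.X 0)) (e : J.homology 0 ≅ ModuleCat.of Λ Λ)
    (hex : Limits.IsZero ((((homFunctor (Λ := Λ) B).mapHomologicalComplex _).obj J).homology 1))
    (E : ModuleCat.{u} Λ) (ι : ModuleCat.of Λ Λ ⟶ E) (π : E ⟶ ModuleCat.of Λ B)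
    (hι : Function.Injective ι.hom) (hπ : Function.Surjective π.hom)
    (hιπ : Function.Exact ι.hom π.hom) :
    ∃ r : E ⟶ ModuleCat.of Λ Λ, ι ≫ r = 𝟙 _ := by
  have hmono : Mono ι := (ModuleCat.mono_iff_injective ι).2 hι
  have hepi : Epi π := (ModuleCat.epi_iff_surjective π).2 hπ
  have hzero : ι ≫ π = 0 := ModuleCat.hom_ext (LinearMap.ext fun x => (hιπ _).2 ⟨x, rfl⟩)
  have hproj : Projective (ModuleCat.of Λ Λ) :=
    (IsProjective.iff_projective Λ).1 inferInstance
  let s : ModuleCat.of Λ Λ ⟶ J.cycles 0 := Projective.factorThru e.inv (J.homologyπ 0)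
  have hs : s ≫ J.homologyπ 0 = e.inv := Projective.factorThru_comp _ _
  let t : E ⟶ J.X 0 := Injective.factorThru (s ≫ J.iCycles 0) ι
  have ht : ι ≫ t = s ≫ J.iCycles 0 := Injective.comp_factorThru _ _
  have hS : (ShortComplex.mk ι π hzero).Exact :=
    (ShortComplex.ShortExact.moduleCat_exact_iff_function_exact _).2 hιπ
  obtain ⟨f, hf⟩ : ∃ f : ModuleCat.of Λ B ⟶ J.X 1, π ≫ f = t ≫ J.d 0 1 := by
    have h₀ : ι ≫ t ≫ J.d 0 1 = 0 := by
      rw [← Category.assoc, ht, Category.assoc, J.iCycles_d, Limits.comp_zero]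
    exact ⟨hS.gIsCokernel.desc (Limits.CokernelCofork.ofπ _ h₀),
      hS.gIsCokernel.fac _ Limits.WalkingParallelPair.one⟩
  have hfd : f ≫ J.d 1 2 = 0 := by
    rw [← cancel_epi π, ← Category.assoc, hf, Category.assoc, J.d_comp_d, Limits.comp_zero,
      Limits.comp_zero]
  obtain ⟨g, hg⟩ : ∃ g : ModuleCat.of Λ B ⟶ J.X 0, g ≫ J.d 0 1 = f := by
    rw [← HomologicalComplex.exactAt_iff_isZero_homology,
      HomologicalComplex.exactAt_iff' _ 0 1 2 (by simp) (by simp),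
      ShortComplex.moduleCat_exact_iff] at hex
    obtain ⟨g, hg⟩ := hex (show BimodHom (Λ := Λ) B (J.X 1) from f.hom)
      (congrArg ModuleCat.Hom.hom hfd)
    exact ⟨ModuleCat.ofHom (show B →ₗ[Λ] J.X 0 from g), ModuleCat.hom_ext hg⟩
  have hcyc : (t - π ≫ g) ≫ J.d 0 1 = 0 := by
    rw [Preadditive.sub_comp, Category.assoc, hg, hf, sub_self]
  refine ⟨J.liftCycles (t - π ≫ g) 1 (by simp) hcyc ≫ J.homologyπ 0 ≫ e.hom, ?_⟩
  have h₁ : ι ≫ J.liftCycles (t - π ≫ g) 1 (by simp) hcyc = s := by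
    rw [← cancel_mono (J.iCycles 0), Category.assoc, HomologicalComplex.liftCycles_i,
      Preadditive.comp_sub, ht, ← Category.assoc, hzero, Limits.zero_comp, sub_zero]
  rw [← Category.assoc, h₁, ← Category.assoc, hs, Iso.inv_hom_id]

attribute [local instance] HasDerivedCategory.standard

/-- A 2-hereditary algebra has only inner derivations with values in `Λ ⊗ Λ`. -/
theorem derivationsInner_of_isNHereditary (h : IsNHereditary k Λ 2) : DerivationsInner k Λ := by
  obtain ⟨-, -, X, hX, hvan⟩ := h
  obtain ⟨J, hJ, ⟨e₁⟩, ⟨e₂⟩⟩ := hX.pred 0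
  obtain ⟨e₀⟩ := hX.zero
  refine derivationsInner_of_retractions k Λ
    (exists_retraction (B := DualBimodule k Λ) J (hJ.1 0).1 ?_ ?_)
  · have e₃ : X (-((0 : ℕ) : ℤ)) ≅ X 0 := eqToIso (by simp)
    refine ((DerivedCategory.homologyFunctorFactors (ModuleCat.{u} Λ) 0).app J).symm ≪≫
      (DerivedCategory.homologyFunctor (ModuleCat.{u} Λ) 0).mapIso (e₁ ≪≫ e₃ ≪≫ e₀) ≪≫ ?_
    exact (DerivedCategory.singleFunctorCompHomologyFunctorIso (ModuleCat.{u} Λ) 0).app _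
  -- 𝕊₂^{-1}Λ is 𝕊^{-1}Λ shifted by 2, so its cohomology in the odd degree −1 is that of Hom(DΛ, J)
  -- in degree 1.
  · have h₁ := hvan (-1) (-1) (by decide)
    have e₄ : X (-((0 : ℕ) : ℤ) - 1) ≅ X (-1) := eqToIso (by simp)
    have e₅ := ((DerivedCategory.homologyFunctor (ModuleCat.{u} Λ) 0).shiftIso
      (-(((2 : ℕ) : ℤ) * (-1))) (-1) 1 (by decide)).app (X (-1))
    have e₆ := (DerivedCategory.homologyFunctor (ModuleCat.{u} Λ) 1).mapIso (e₂ ≪≫ e₄)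
    exact ((h₁.of_iso e₅.symm).of_iso e₆).of_iso
      ((DerivedCategory.homologyFunctorFactors (ModuleCat.{u} Λ) 1).app _).symm

end Complexes

/-! ### Connected quivers in which every arrow is a leaf -/

section StarShape

variable {V : Type} [Quiver.{0} V]

/-- In a connected quiver all of whose arrows are leaves, every vertex other than the middle of a
path of length two is a neighbour of it. -/
theorem eq_or_nonempty_hom (hconn : Subsingleton (Quiver.WeaklyConnectedComponent V))
    (hleaf : ∀ {i j : V} (a : i ⟶ j), IsLeafSource a ∨ IsLeafSink a)
    {i z j : V} (a : i ⟶ z) (b : z ⟶ j) (v : V) :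
    v = z ∨ Nonempty (v ⟶ z) ∨ Nonempty (z ⟶ v) := by
  obtain ⟨p⟩ := (Quiver.WeaklyConnectedComponent.eq z v).1 (Subsingleton.elim _ _)
  -- Follow a walk from z. A neighbour of z is a leaf, because its arrow cannot be a leaf at z,
  -- which has arrows on both sides; the next step can only return to z.
  induction p with
  | nil => exact Or.inl rfl
  | @cons v w p e ih =>
    rcases ih with rfl | ⟨⟨c⟩⟩ | ⟨⟨c⟩⟩
    · rcases e with e | e
      · exact Or.inr (Or.inr ⟨e⟩)
      · exact Or.inr (Or.inl ⟨e⟩)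
    · rcases hleaf c with hc | hc
      · rcases e with e | e
        · have h := hc.1 _ e
          exact Or.inl (congrArg Sigma.fst h)
        · exact ((hc.2 _).false e).elim
      · exact ((hc.2 _).false b).elim
    · rcases hleaf c with hc | hc
      · exact ((hc.2 _).false a).elim
      · rcases e with e | e
        · exact ((hc.2 _).false e).elim
        · have h := hc.1 _ e
          exact Or.inl (congrArg Sigma.fst h)

/-- A finite connected quiver all of whose arrows are leaves, and which contains a path of length
two, is a star. -/
theorem nonempty_iso_star [∀ i j : V, Finite (i ⟶ j)] [Finite V]
    (hconn : Subsingleton (Quiver.WeaklyConnectedComponent V))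
    (hleaf : ∀ {i j : V} (a : i ⟶ j), IsLeafSource a ∨ IsLeafSink a)
    {i z j : V} (a : i ⟶ z) (b : z ⟶ j) :
    ∃ r s : ℕ, 1 ≤ r ∧ 1 ≤ s ∧ Nonempty (Quiv.of V ≅ Quiv.of (StarVertex r s)) := by
  have hin : ∀ {v : V} (c : v ⟶ z), IsLeafSource c := fun c =>
    (hleaf c).resolve_right fun h => (h.2 _).false b
  have hout : ∀ {v : V} (c : z ⟶ v), IsLeafSink c := fun c =>
    (hleaf c).resolve_left fun h => (h.2 _).false a
  let A := {v : V // Nonempty (v ⟶ z)}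
  let B := {v : V // Nonempty (z ⟶ v)}
  obtain ⟨r, ⟨eA⟩⟩ := Finite.exists_equiv_fin A
  obtain ⟨s, ⟨eB⟩⟩ := Finite.exists_equiv_fin B
  let f : StarVertex r s → V
    | .source i => (eA.symm i).1
    | .center => z
    | .sink j => (eB.symm j).1
  have hA : ∀ i, Nonempty ((eA.symm i).1 ⟶ z) := fun i => (eA.symm i).2
  have hB : ∀ j, Nonempty (z ⟶ (eB.symm j).1) := fun j => (eB.symm j).2
  have hzz : IsEmpty (z ⟶ z) := ⟨fun e => ((hin e).2 _).false e⟩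
  have hAz : ∀ i, (eA.symm i).1 ≠ z := fun i h => by
    have c := (hA i).some
    rw [h] at c
    exact hzz.false c
  have hBz : ∀ j, (eB.symm j).1 ≠ z := fun j h => by
    have c := (hB j).some
    rw [h] at c
    exact hzz.false c
  have hAB : ∀ i j, (eA.symm i).1 ≠ (eB.symm j).1 := fun i j h =>
    ((hin (hA i).some).2 _).false (h ▸ (hB j).some)
  have hf : Function.Bijective f := by
    constructor
    · rintro (i | _ | j) (i' | _ | j') h
      · exact congrArg _ (eA.symm.injective (Subtype.ext h))
      · exact absurd h (hAz i)
      · exact absurd h (hAB i j')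
      · exact absurd h.symm (hAz i')
      · rfl
      · exact absurd h.symm (hBz j')
      · exact absurd h.symm (hAB i' j)
      · exact absurd h (hBz j)
      · exact congrArg _ (eB.symm.injective (Subtype.ext h))
    · intro v
      rcases eq_or_nonempty_hom hconn hleaf a b v with rfl | h | h
      · exact ⟨.center, rfl⟩
      · exact ⟨.source (eA ⟨v, h⟩), by simp [f]⟩
      · exact ⟨.sink (eB ⟨v, h⟩), by simp [f]⟩
  have hhom : ∀ X Y : StarVertex r s, Nonempty ((X ⟶ Y) ≃ (f X ⟶ f Y)) := by
    have empty : ∀ {X Y : StarVertex r s}, IsEmpty (X ⟶ Y) → IsEmpty (f X ⟶ f Y) →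
        Nonempty ((X ⟶ Y) ≃ (f X ⟶ f Y)) := fun _ _ => ⟨Equiv.equivOfIsEmpty _ _⟩
    rintro (i | _ | j) (i' | _ | j')
    · exact empty ⟨fun e => nomatch e⟩ ((hin (hA i').some).2 _)
    -- The leaf condition also excludes parallel arrows, so this set of arrows is a singleton.
    · refine ⟨⟨fun _ => (hA i).some, fun _ => StarArrow.a i, fun e => ?_, fun e => ?_⟩⟩
      · match e with
        | StarArrow.a _ => rfl
      · exact (eq_of_heq (Sigma.mk.inj ((hin (hA i).some).1 _ e)).2).symm
    · refine empty ⟨fun e => nomatch e⟩ ⟨fun e => ?_⟩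
      exact hAz i (congrArg Sigma.fst ((hout (hB j').some).1 _ e))
    · exact empty ⟨fun e => nomatch e⟩ ((hin (hA i').some).2 _)
    · exact empty ⟨fun e => nomatch e⟩ hzz
    · refine ⟨⟨fun _ => (hB j').some, fun _ => StarArrow.b j', fun e => ?_, fun e => ?_⟩⟩
      · match e with
        | StarArrow.b _ => rfl
      · exact (eq_of_heq (Sigma.mk.inj ((hout (hB j').some).1 _ e)).2).symm
    · exact empty ⟨fun e => nomatch e⟩ ((hin (hA i').some).2 _)
    · exact empty ⟨fun e => nomatch e⟩ ((hout (hB j).some).2 _)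
    · exact empty ⟨fun e => nomatch e⟩ ((hout (hB j).some).2 _)
  refine ⟨r, s, ?_, ?_, ⟨(Quiv.isoOfEquiv (Equiv.ofBijective f hf)
    fun X Y => (hhom X Y).some).symm⟩⟩
  · have := (eA ⟨i, ⟨a⟩⟩).pos
    omega
  · have := (eB ⟨j, ⟨b⟩⟩).pos
    omega

end StarShape

/-! ### Transport along an isomorphism of quivers -/

section Functoriality

variable (k : Type u) [Field k] {V W : Type} [Quiver.{0} V] [Quiver.{0} W]

/-- The image of a path under a morphism of quivers. -/
def mapQPath (F : V ⥤q W) (p : QPath V) : QPath W := ⟨F.obj p.1, F.obj p.2.1, F.mapPath p.2.2⟩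

/-- The linear map between path algebras induced by a morphism of quivers. -/
def mapPathAlgebra (F : V ⥤q W) : PathAlgebra k V →ₗ[k] PathAlgebra k W :=
  (Finsupp.lmapDomain k k (mapQPath F) : (QPath V →₀ k) →ₗ[k] (QPath W →₀ k))

theorem mapPathAlgebra_ofPath (F : V ⥤q W) (p : QPath V) :
    mapPathAlgebra k F (ofPath k p) = ofPath k (mapQPath F p) :=
  Finsupp.mapDomain_single

theorem mapQPath_comp {U : Type} [Quiver.{0} U] (F : V ⥤q W) (G : W ⥤q U) (p : QPath V) :
    mapQPath G (mapQPath F p) = mapQPath (F ⋙q G) p := by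
  simp only [mapQPath, Prefunctor.mapPath_comp_apply]
  rfl

theorem mapQPath_id (p : QPath V) : mapQPath (𝟭q V) p = p := by
  simp only [mapQPath, Prefunctor.mapPath_id]
  rfl

theorem mapPathAlgebra_comp_of_eq_id {F : V ⥤q W} {G : W ⥤q V} (h : F ⋙q G = 𝟭q V)
    (x : PathAlgebra k V) : mapPathAlgebra k G (mapPathAlgebra k F x) = x := by
  induction x using PathAlgebra.induction_on with
  | h0 => rw [map_zero, map_zero]
  | hadd a b ha hb => rw [map_add, map_add, ha, hb]
  | hs c p =>
    rw [map_smul, map_smul, mapPathAlgebra_ofPath, mapPathAlgebra_ofPath, mapQPath_comp, h,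
      mapQPath_id]

/-- Injectivity on vertices keeps non-composable paths non-composable, so that zero products stay
zero. -/
theorem mapPathAlgebra_mul (F : V ⥤q W) (hF : Function.Injective F.obj) (x y : PathAlgebra k V) :
    mapPathAlgebra k F (x * y) = mapPathAlgebra k F x * mapPathAlgebra k F y := by
  refine bilinear_ext k (f := fun x y => mapPathAlgebra k F (x * y))
    (g := fun x y => mapPathAlgebra k F x * mapPathAlgebra k F y)
    ?_ ?_ ?_ ?_ ?_ ?_ ?_ ?_ ?_ x y
  any_goals
    intros; simp [add_mul, mul_add, smul_mul_path, mul_smul_path]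
  rintro ⟨p₁, p₂, p⟩ ⟨q₁, q₂, q⟩
  rw [ofPath_mul_ofPath, mapPathAlgebra_ofPath, mapPathAlgebra_ofPath, ofPath_mul_ofPath]
  by_cases h : q₂ = p₁
  · subst h
    rw [pathMul_mk, mapPathAlgebra_ofPath, mapQPath, mapQPath, mapQPath, pathMul_mk,
      Prefunctor.mapPath_comp]
  · rw [pathMul_ne _ _ _ h, map_zero, pathMul_ne _ _ _ fun e => h (hF e)]

theorem length_mapQPath (F : V ⥤q W) (p : QPath V) :
    (mapQPath F p).2.2.length = p.2.2.length := by
  obtain ⟨i, j, p⟩ := p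
  induction p with
  | nil => rfl
  | cons p a ih =>
    simp only [mapQPath, Prefunctor.mapPath_cons, Quiver.Path.length_cons] at ih ⊢
    rw [ih]

variable [Fintype V] [Fintype W]

/-- Isomorphic quivers have isomorphic path algebras. -/
def pathAlgebraEquiv (F : V ⥤q W) (G : W ⥤q V) (hFG : F ⋙q G = 𝟭q V) (hGF : G ⋙q F = 𝟭q W) :
    PathAlgebra k V ≃ₐ[k] PathAlgebra k W :=
  let e : V ≃ W := ⟨F.obj, G.obj, Prefunctor.congr_obj hFG, Prefunctor.congr_obj hGF⟩
  AlgEquiv.ofLinearEquiv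
    { mapPathAlgebra k F with
      invFun := mapPathAlgebra k G
      left_inv := mapPathAlgebra_comp_of_eq_id k hFG
      right_inv := mapPathAlgebra_comp_of_eq_id k hGF }
    (by
      change mapPathAlgebra k F 1 = 1
      rw [one_def, map_sum, one_def]
      exact Fintype.sum_equiv e _ _ fun i => mapPathAlgebra_ofPath k _ _)
    (mapPathAlgebra_mul k F e.injective)

variable (F : V ⥤q W) (G : W ⥤q V) (hFG : F ⋙q G = 𝟭q V) (hGF : G ⋙q F = 𝟭q W)

theorem pathAlgebraEquiv_ofPath (p : QPath V) :
    pathAlgebraEquiv k F G hFG hGF (ofPath k p) = ofPath k (mapQPath F p) :=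
  mapPathAlgebra_ofPath k _ p

variable {k}

include hFG hGF in
/-- An isomorphism of quivers carries a quadratic monomial algebra to another one. -/
theorem exists_boundQuiverAlgebra_equiv
    {I : TwoSidedIdeal (PathAlgebra k V)} {M : Set (QPath V)} (hIM : I = pathIdeal k M) :
    Nonempty (BoundQuiverAlgebra I ≃ₐ[k] BoundQuiverAlgebra (pathIdeal k (mapQPath F '' M))) := by
  let Φ := pathAlgebraEquiv k F G hFG hGF
  have h₁ : pathIdeal k (mapQPath F '' M) ≤ I.comap Φ.symm.toRingEquiv := by
    refine TwoSidedIdeal.span_le.2 ?_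
    rintro _ ⟨_, ⟨p, hp, rfl⟩, rfl⟩
    refine (TwoSidedIdeal.mem_comap _).2 ?_
    change Φ.symm _ ∈ I
    rw [← pathAlgebraEquiv_ofPath k F G hFG hGF, AlgEquiv.symm_apply_apply, hIM]
    exact TwoSidedIdeal.subset_span ⟨p, hp, rfl⟩
  have h₂ : I ≤ (pathIdeal k (mapQPath F '' M)).comap Φ.toRingEquiv := by
    conv_lhs => rw [hIM]
    refine TwoSidedIdeal.span_le.2 ?_
    rintro _ ⟨p, hp, rfl⟩
    refine (TwoSidedIdeal.mem_comap _).2 ?_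
    change Φ _ ∈ _
    rw [pathAlgebraEquiv_ofPath]
    exact TwoSidedIdeal.subset_span ⟨_, ⟨p, hp, rfl⟩, rfl⟩
  refine ⟨RingCon.congrₐ k Φ (RingCon.ext fun x y => ?_)⟩
  rw [TwoSidedIdeal.rel_iff]
  change _ ↔ (pathIdeal k (mapQPath F '' M)).ringCon (Φ x) (Φ y)
  rw [TwoSidedIdeal.rel_iff, ← map_sub]
  constructor
  · intro h
    exact (TwoSidedIdeal.mem_comap _).1 (h₂ h)
  · intro h
    have h' : Φ.symm (Φ (x - y)) ∈ I := (TwoSidedIdeal.mem_comap _).1 (h₁ h)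
    rwa [AlgEquiv.symm_apply_apply] at h'

end Functoriality

/-! ### Assembly -/

section Main

theorem StarArrow.not_composable {r s : ℕ} {i j l m : StarVertex r s} (a : StarArrow r s i j)
    (b : StarArrow r s j l) (c : StarArrow r s l m) : False := by
  cases a <;> cases b
  cases c

/-- Ideals of a star generated by paths of length two are admissible. -/
theorem isAdmissible_star {k : Type u} [Field k] {r s : ℕ} {M : Set (QPath (StarVertex r s))}
    (hM : ∀ p ∈ M, p.2.2.length = 2) : IsAdmissible (pathIdeal k M) := by
  -- The exponent 3 works because a star has no path of length three.
  refine ⟨TwoSidedIdeal.span_mono (Set.image_mono hM), 3, by norm_num, ?_⟩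
  refine TwoSidedIdeal.span_le.2 ?_
  rintro _ ⟨⟨i, j, p⟩, hp, rfl⟩
  exfalso
  change p.length = 3 at hp
  cases p with
  | nil => simp at hp
  | cons p c =>
    cases p with
    | nil => simp at hp
    | cons p b =>
      cases p with
      | nil => simp at hp
      | cons p a => exact StarArrow.not_composable a b c

variable {k : Type u} [Field k] {V : Type} [Quiver.{0} V] [Fintype V] [∀ i j : V, Finite (i ⟶ j)]
  [Nonempty V]

theorem nonempty_iso_star_of_derivationsInner
    (hconn : Subsingleton (Quiver.WeaklyConnectedComponent V))
    {I : TwoSidedIdeal (PathAlgebra k V)} (hadm : IsAdmissible I) (hquad : IsQuadraticMonomial I)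
    (hdim : globalDimension (BoundQuiverAlgebra I) = 2)
    (hinn : DerivationsInner k (BoundQuiverAlgebra I)) :
    ∃ r s : ℕ, 1 ≤ r ∧ 1 ≤ s ∧ Nonempty (Quiv.of V ≅ Quiv.of (StarVertex r s)) := by
  obtain ⟨M, hM, hIM⟩ := hquad
  have hrel : ∀ {i j l : V} (a : i ⟶ j) (b : j ⟶ l), arrowPath₂ a b ∈ M →
      arrowElt I b * arrowElt I a = 0 := by
    intro i j l a b h
    rw [arrowElt_mul_arrowElt, proj_eq_zero_iff, hIM]
    exact TwoSidedIdeal.subset_span ⟨_, h, rfl⟩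
  have harrow : ∃ (i j : V), Nonempty (i ⟶ j) := by
    by_contra! hno
    have h := globalDimension_le_zero (I := I) hconn hno
    rw [hdim] at h
    exact absurd h (by decide)
  obtain ⟨i, j, ⟨a⟩⟩ := harrow
  have hleaf : ∀ {i j : V} (a : i ⟶ j), IsLeafSource a ∨ IsLeafSink a :=
    isLeafSource_or_isLeafSink hM hIM hadm.1 hinn fun c a b hca hab =>
      mul_ne_zero_of_mul_eq_zero hadm.1 hdim.le c a b (hrel c a hca) (hrel a b hab)
  -- The relation through a provides the path of length two whose middle is the centre.
  obtain ⟨l, b, -⟩ | ⟨l, c, -⟩ := exists_relation hM hIM hadm.1 hinn a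
  · exact nonempty_iso_star hconn hleaf a b
  · exact nonempty_iso_star hconn hleaf c a

end Main

end StarCor

end

theorem mainTheorem4 {k : Type u} [Field k] [IsAlgClosed k]
    {V : Type} [Quiver.{0} V] [Fintype V] [∀ i j : V, Finite (i ⟶ j)] [Nonempty V]
    (hconn : Subsingleton (Quiver.WeaklyConnectedComponent V))
    (I : TwoSidedIdeal (StarCor.PathAlgebra k V))
    (hadm : StarCor.IsAdmissible I) (hquad : StarCor.IsQuadraticMonomial I) :
    (StarCor.globalDimension (StarCor.BoundQuiverAlgebra I) = 2 →
      Subsingleton (StarCor.ExtEnv k (StarCor.BoundQuiverAlgebra I) 1) →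
      ∃ r s : ℕ, 1 ≤ r ∧ 1 ≤ s ∧
        Nonempty (Quiv.of V ≅ Quiv.of (StarCor.StarVertex r s))) ∧
    (StarCor.IsNHereditary k (StarCor.BoundQuiverAlgebra I) 2 →
      ∃ r s : ℕ, 1 ≤ r ∧ 1 ≤ s ∧
        Nonempty (Quiv.of V ≅ Quiv.of (StarCor.StarVertex r s)) ∧
        ∃ J : TwoSidedIdeal (StarCor.PathAlgebra k (StarCor.StarVertex r s)),
          StarCor.IsAdmissible J ∧ StarCor.IsQuadraticMonomial J ∧
          Nonempty (StarCor.BoundQuiverAlgebra I ≃ₐ[k] StarCor.BoundQuiverAlgebra J)) := by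
  refine ⟨fun hdim hext => StarCor.nonempty_iso_star_of_derivationsInner hconn hadm hquad hdim
    (StarCor.derivationsInner_of_subsingleton_ext hext), fun h => ?_⟩
  obtain ⟨r, s, hr, hs, ⟨e⟩⟩ := StarCor.nonempty_iso_star_of_derivationsInner hconn hadm hquad
    h.2.1 (StarCor.derivationsInner_of_isNHereditary h)
  obtain ⟨M, hM, hIM⟩ := hquad
  have hM' : ∀ p ∈ StarCor.mapQPath e.hom '' M, p.2.2.length = 2 := by
    rintro _ ⟨p, hp, rfl⟩
    exact (StarCor.length_mapQPath e.hom p).trans (hM p hp)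
  exact ⟨r, s, hr, hs, ⟨e⟩, StarCor.pathIdeal k (StarCor.mapQPath e.hom '' M),
    StarCor.isAdmissible_star hM', ⟨_, hM', rfl⟩,
    StarCor.exists_boundQuiverAlgebra_equiv
      (V := V) (W := StarCor.StarVertex r s) e.hom e.inv e.hom_inv_id e.inv_hom_id hIM⟩
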